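/- All groups are finite; for a group $G$ (resp. a positive integer $n$), $\pi(G)$ (resp. $\pi(n)$) denotes the set of prime divisors of $|G|$ (resp. of $n$). A (directed) graph has a vertex set and a set of ordered pairs of vertices as edges (loops allowed); $\Gamma_1\subseteq\Gamma_2$ means containment of both the vertex sets and the edge sets, unions of graphs are taken on vertices and on edges, and a graph given only by its set of edges has as vertices the endpoints of these edges. The Hawkes graph $\Gamma_H(G)$ has vertex set $\pi(G)$ and an edge $(p,q)$ whenever $p\in\pi(G)$ and $q\in\pi(G/\mathrm{O}_{p',p}(G))$, where $\mathrm{O}_{p',p}(G)$ is defined by $\mathrm{O}_{p',p}(G)/\mathrm{O}_{p'}(G)=\mathrm{O}_p(G/\mathrm{O}_{p'}(G))$. The $N$-critical graph $\Gamma_{Nc}(G)$ has vertex set $\pi(G)$ and an edge $(p,q)$ whenever $G$ contains a Schmidt $(p,q)$-subgroup, i.e. a non-nilpotent subgroup $S$ all of whose proper subgroups are nilpotent, with $\pi(S)=\{p,q\}$ and a normal Sylow $p$-subgroup. For subgroups $A,B$ of $G$ let $$\Gamma(A,B)=\{(p,q)\mid p\in\pi(A),\ q\in\pi(B)\cap\pi(p-1)\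 \text{ or }\ p\in\pi(B),\ q\in\pi(A)\cap\pi(p-1)\}.$$ Subgroups $A,B$ are mutually permutable if $A$ permutes with every subgroup of $B$ and $B$ permutes with every subgroup of $A$ ($H$ and $K$ permute if $HK=KH$). **Theorem.** Let $G$ be a finite group and let $G_1,\dots,G_n$ be soluble subgroups of $G$ such that $G=G_1G_2\cdots G_n$ and $G_i$, $G_j$ are mutually permutable whenever $i\neq j$. Then $$\Gamma_H(G)\subseteq\bigcup_{1\le i\le n}\Gamma_H(G_i)\ \cup\bigcup_{1\le i,j\le n,\ i\ne j}\Gamma(G_i,G_j)\ \cup\ \{(p,p)\mid p\in\pi(G)\}$$ and $$\Gamma_{Nc}(G)\subseteq\bigcup_{1\le i\le n}\Gamma_{Nc}(G_i)\ \cup\bigcup_{1\le i,j\le n,\ i\ne j}\Gamma(G_i,G_j).$$ -/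

import Mathlib

open scoped Pointwise

/-- A directed graph on natural numbers with an explicit vertex set; edges are ordered pairs of
vertices, and loops are allowed. -/
@[ext]
structure ArithGraph where
  verts : Set ℕ
  edges : Set (ℕ × ℕ)
  edge_mem : ∀ e ∈ edges, e.1 ∈ verts ∧ e.2 ∈ verts

namespace ArithGraph

/-- `Γ₁ ⊆ Γ₂`: containment of both the vertex sets and the edge sets. -/
instance : HasSubset ArithGraph :=
  ⟨fun Γ₁ Γ₂ => Γ₁.verts ⊆ Γ₂.verts ∧ Γ₁.edges ⊆ Γ₂.edges⟩

/-- The union of two graphs: union of the vertex sets and of the edge sets. -/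
instance : Union ArithGraph :=
  ⟨fun Γ₁ Γ₂ =>
    { verts := Γ₁.verts ∪ Γ₂.verts
      edges := Γ₁.edges ∪ Γ₂.edges
      edge_mem := fun e he => he.elim
        (fun h => ⟨Or.inl (Γ₁.edge_mem e h).1, Or.inl (Γ₁.edge_mem e h).2⟩)
        (fun h => ⟨Or.inr (Γ₂.edge_mem e h).1, Or.inr (Γ₂.edge_mem e h).2⟩) }⟩

/-- The union of a family of graphs. -/
def iUnion {ι : Type*} (Γ : ι → ArithGraph) : ArithGraph where
  verts := ⋃ i, (Γ i).verts
  edges := ⋃ i, (Γ i).edges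
  edge_mem := fun e he => by
    obtain ⟨i, hi⟩ := Set.mem_iUnion.1 he
    exact ⟨Set.mem_iUnion.2 ⟨i, ((Γ i).edge_mem e hi).1⟩,
      Set.mem_iUnion.2 ⟨i, ((Γ i).edge_mem e hi).2⟩⟩

/-- The graph without isolated vertices that has the given set of edges: its vertices are the
endpoints of its edges. -/
def ofEdges (E : Set (ℕ × ℕ)) : ArithGraph where
  verts := Prod.fst '' E ∪ Prod.snd '' E
  edges := E
  edge_mem := fun e he => ⟨Or.inl ⟨e, he, rfl⟩, Or.inr ⟨e, he, rfl⟩⟩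

end ArithGraph

/-- `π(n)`: the set of prime divisors of `n`. -/
def primeDivs (n : ℕ) : Set ℕ := {p | p.Prime ∧ p ∣ n}

/-- `π(G)`: the set of prime divisors of the order of `G`. -/
def groupPrimes (G : Type*) : Set ℕ := primeDivs (Nat.card G)

/-- `O_π(G)`: the greatest normal `π`-subgroup, as the join of all normal `π`-subgroups. -/
def oPi (π : Set ℕ) (G : Type*) [Group G] : Subgroup G :=
  sSup {N : Subgroup G | N.Normal ∧ groupPrimes N ⊆ π}

instance oPi_normal (π : Set ℕ) (G : Type*) [Group G] : (oPi π G).Normal := by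
  unfold oPi
  exact Subgroup.sSup_normal _ (fun _ hN => hN.1)

/-- `O_{p',p}(G)`: the preimage of `O_p(G / O_{p'}(G))` in `G`. -/
def oPrimeP (p : ℕ) (G : Type*) [Group G] : Subgroup G :=
  (oPi {p} (G ⧸ oPi {r | r.Prime ∧ r ≠ p} G)).comap
    (QuotientGroup.mk' (oPi {r | r.Prime ∧ r ≠ p} G))

/-- A Schmidt group: a non-nilpotent group all of whose proper subgroups are nilpotent. -/
def IsSchmidt (S : Type*) [Group S] : Prop :=
  ¬ Group.IsNilpotent S ∧ ∀ H : Subgroup S, H ≠ ⊤ → Group.IsNilpotent H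

/-- A Schmidt `(p, q)`-group: a Schmidt group `S` with `π(S) = {p, q}` and a normal Sylow
`p`-subgroup. -/
def IsSchmidtPair (p q : ℕ) (S : Type*) [Group S] : Prop :=
  IsSchmidt S ∧ groupPrimes S = {p, q} ∧ ∃ P : Sylow p S, (P : Subgroup S).Normal

theorem groupPrimes_subset_of_dvd {m n : ℕ} (h : m ∣ n) : primeDivs m ⊆ primeDivs n :=
  fun _ hp => ⟨hp.1, hp.2.trans h⟩

/-- The Hawkes graph: vertex set `π(G)`, with an edge `(p, q)` whenever `p ∈ π(G)` and
`q ∈ π(G / O_{p',p}(G))`. -/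
def hawkesGraph (G : Type*) [Group G] : ArithGraph where
  verts := groupPrimes G
  edges := {e | e.1 ∈ groupPrimes G ∧ e.2 ∈ groupPrimes (G ⧸ oPrimeP e.1 G)}
  edge_mem := fun _ he =>
    ⟨he.1, groupPrimes_subset_of_dvd (oPrimeP _ G).card_quotient_dvd_card he.2⟩

/-- The `N`-critical graph: vertex set `π(G)`, with an edge `(p, q)` whenever `G` contains a
Schmidt `(p, q)`-subgroup. -/
def nCriticalGraph (G : Type*) [Group G] : ArithGraph where
  verts := groupPrimes G
  edges := {e | ∃ S : Subgroup G, IsSchmidtPair e.1 e.2 S}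
  edge_mem := by
    rintro ⟨p, q⟩ ⟨S, -, hS, -⟩
    have h : groupPrimes S ⊆ groupPrimes G :=
      groupPrimes_subset_of_dvd S.card_subgroup_dvd_card
    refine ⟨h ?_, h ?_⟩ <;> simp [hS]

/-- `Γ(A, B)`: the graph defined by its edges `(p, q)`, where `q` divides `p - 1` and either
`p ∈ π(A)`, `q ∈ π(B)` or `p ∈ π(B)`, `q ∈ π(A)`. -/
def pairGraph {G : Type*} [Group G] (A B : Subgroup G) : ArithGraph :=
  ArithGraph.ofEdges
    {e | (e.1 ∈ groupPrimes A ∧ e.2 ∈ groupPrimes B ∩ primeDivs (e.1 - 1)) ∨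
         (e.1 ∈ groupPrimes B ∧ e.2 ∈ groupPrimes A ∩ primeDivs (e.1 - 1))}

/-- The graph with edges the loops `(p, p)`, `p ∈ π(G)`. -/
def loopGraph (G : Type*) : ArithGraph :=
  ArithGraph.ofEdges {e | e.1 ∈ groupPrimes G ∧ e.2 = e.1}

/-- Two subgroups permute: `HK = KH`. -/
def Permutes {G : Type*} [Group G] (H K : Subgroup G) : Prop :=
  (H : Set G) * (K : Set G) = (K : Set G) * (H : Set G)

/-- Mutually permutable subgroups: `A` permutes with every subgroup of `B`, and `B` permutes with
every subgroup of `A`. -/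
def MutuallyPermutable {G : Type*} [Group G] (A B : Subgroup G) : Prop :=
  (∀ K : Subgroup G, K ≤ B → Permutes A K) ∧ (∀ K : Subgroup G, K ≤ A → Permutes B K)

/-- `G = G₁ G₂ ⋯ Gₙ`: every element is a product `g₁ g₂ ⋯ gₙ` with `gᵢ ∈ Gᵢ`. -/
def IsProductOf {G : Type*} [Group G] {n : ℕ} (H : Fin n → Subgroup G) : Prop :=
  (List.ofFn fun i => (H i : Set G)).prod = Set.univ

/-! For distinct primes `p` and `q`, let `ActsTrivially p q G` mean that every `q`-element
normalizing a `p`-subgroup of `G` centralizes it. Its failure is exactly an edge `(p, q)` of the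
`N`-critical graph (`mem_nCriticalGraph_edges`) and, for soluble `G`, an off-diagonal edge of the
Hawkes graph (`mem_hawkesGraph_edges`); loops of the Hawkes graph are absorbed by `loopGraph`. Both
inclusions thus follow from the solubility of `G` and from `MutPermProduct.actsTrivially`: the
property passes from the factors to `G` unless `q ∣ p - 1` for some `p` and `q` dividing the orders
of two different factors.

Both facts are proved by induction on `|G|`, starting from `MutPermProduct.exists_mem_oPi`: some
factor meets some `O_r(G)` nontrivially. To find such an element, take `x` in `O_r(A)` for a factor
`A`, with `x` in the derived subgroup of `A`, or with `r` the largest prime divisor of `|G|` if all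
factors are abelian. For `b` in another factor `B`, the subgroup `A⟨b⟩` is reached from `A` by steps
of prime index `s`. At such a step the smaller subgroup modulo its core embeds in the abelian group
of automorphisms of a group of order `s`, so `x` lies in the core and stays in the `r`-core. The
Baer–Suzuki theorem then puts `x` into `O_r(AB)`, and a Sylow argument (`Permutes.mem_coreIn_sup`)
extends this to all factors.

In the induction for `ActsTrivially`, if `r ≠ p` one factors out the `p'`-group `O_r(G)`. If `r =
p`, one factors out the subgroup `R` generated by the intersections of `O_p(G)` with the factors: it
is normal, and `q`-elements of each factor centralize it, by the hypothesis on that factor and,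
across two factors, by a count of fixed points modulo `q` (`commute_of_mutuallyPermutable`). Hence
all `q`-elements of `G` centralize `R`, and coprime action lifts the property from `G/R`. -/

/-! ### Permutable and mutually permutable subgroups -/

section Permutes

variable {G : Type*} [Group G] {H K L : Subgroup G}

theorem permutes_iff :
    Permutes H K ↔ ∀ h ∈ H, ∀ k ∈ K, ∃ k' ∈ K, ∃ h' ∈ H, h * k = k' * h' := by
  constructor
  · intro hp h hh k hk
    have : h * k ∈ (K : Set G) * (H : Set G) := hp ▸ Set.mul_mem_mul hh hk
    obtain ⟨k', hk', h', hh', e⟩ := Set.mem_mul.1 this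
    exact ⟨k', hk', h', hh', e.symm⟩
  · intro hp
    apply Set.Subset.antisymm
    · rintro _ ⟨h, hh, k, hk, rfl⟩
      obtain ⟨k', hk', h', hh', e⟩ := hp h hh k hk
      exact Set.mem_mul.2 ⟨k', hk', h', hh', e.symm⟩
    · rintro _ ⟨k, hk, h, hh, rfl⟩
      obtain ⟨k', hk', h', hh', e⟩ := hp h⁻¹ (H.inv_mem hh) k⁻¹ (K.inv_mem hk)
      refine Set.mem_mul.2 ⟨h'⁻¹, H.inv_mem hh', k'⁻¹, K.inv_mem hk', ?_⟩
      have := congrArg Inv.inv e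
      simpa using this.symm

namespace Permutes

theorem symm (h : Permutes H K) : Permutes K H := Eq.symm h

theorem refl (H : Subgroup G) : Permutes H H := Eq.refl _

theorem exists_eq (hp : Permutes H K) {h k : G} (hh : h ∈ H) (hk : k ∈ K) :
    ∃ k' ∈ K, ∃ h' ∈ H, h * k = k' * h' :=
  permutes_iff.1 hp h hh k hk

theorem of_le (h : H ≤ K) : Permutes H K :=
  permutes_iff.2 fun x hx k hk => ⟨x * k, K.mul_mem (h hx) hk, 1, H.one_mem, by simp⟩

theorem mem_sup (hp : Permutes H K) {x : G} : x ∈ H ⊔ K ↔ ∃ h ∈ H, ∃ k ∈ K, h * k = x := by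
  constructor
  · intro hx
    refine Subgroup.closure_induction
      (p := fun x _ => ∃ h ∈ H, ∃ k ∈ K, h * k = x) ?_ ?_ ?_ ?_
      (show x ∈ Subgroup.closure ((H : Set G) ∪ K) by
        rwa [Subgroup.closure_union, Subgroup.closure_eq, Subgroup.closure_eq])
    · rintro y (hy | hy)
      · exact ⟨y, hy, 1, K.one_mem, by simp⟩
      · exact ⟨1, H.one_mem, y, hy, by simp⟩
    · exact ⟨1, H.one_mem, 1, K.one_mem, by simp⟩
    · rintro _ _ - - ⟨h, hh, k, hk, rfl⟩ ⟨h₁, hh₁, k₁, hk₁, rfl⟩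
      obtain ⟨h₂, hh₂, k₂, hk₂, e⟩ := hp.symm.exists_eq hk hh₁
      refine ⟨h * h₂, H.mul_mem hh hh₂, k₂ * k₁, K.mul_mem hk₂ hk₁, ?_⟩
      calc h * h₂ * (k₂ * k₁) = h * (h₂ * k₂) * k₁ := by group
        _ = h * k * (h₁ * k₁) := by rw [← e]; group
    · rintro _ - ⟨h, hh, k, hk, rfl⟩
      obtain ⟨h₂, hh₂, k₂, hk₂, e⟩ := hp.symm.exists_eq (K.inv_mem hk) (H.inv_mem hh)
      exact ⟨h₂, hh₂, k₂, hk₂, by rw [← e]; group⟩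
  · rintro ⟨h, hh, k, hk, rfl⟩
    exact mul_mem (Subgroup.mem_sup_left hh) (Subgroup.mem_sup_right hk)

theorem sup_right (hK : Permutes H K) (hL : Permutes H L) : Permutes H (K ⊔ L) := by
  have key : ∀ x ∈ K ⊔ L, (∀ h ∈ H, ∃ k' ∈ K ⊔ L, ∃ h' ∈ H, h * x = k' * h') ∧
      ∀ h ∈ H, ∃ k' ∈ K ⊔ L, ∃ h' ∈ H, h * x⁻¹ = k' * h' := by
    intro x hx
    have gen : ∀ y ∈ (K : Set G) ∪ L, ∀ h ∈ H, ∃ k' ∈ K ⊔ L, ∃ h' ∈ H, h * y = k' * h' := by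
      rintro y (hy | hy) h hh
      · obtain ⟨k', hk', h', hh', e⟩ := hK.exists_eq hh hy
        exact ⟨k', Subgroup.mem_sup_left hk', h', hh', e⟩
      · obtain ⟨k', hk', h', hh', e⟩ := hL.exists_eq hh hy
        exact ⟨k', Subgroup.mem_sup_right hk', h', hh', e⟩
    have mul : ∀ x y : G, (∀ h ∈ H, ∃ k' ∈ K ⊔ L, ∃ h' ∈ H, h * x = k' * h') →
        (∀ h ∈ H, ∃ k' ∈ K ⊔ L, ∃ h' ∈ H, h * y = k' * h') →
        ∀ h ∈ H, ∃ k' ∈ K ⊔ L, ∃ h' ∈ H, h * (x * y) = k' * h' := by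
      intro x y hx hy h hh
      obtain ⟨k₁, hk₁, h₁, hh₁, e₁⟩ := hx h hh
      obtain ⟨k₂, hk₂, h₂, hh₂, e₂⟩ := hy h₁ hh₁
      exact ⟨k₁ * k₂, mul_mem hk₁ hk₂, h₂, hh₂, by
        rw [← mul_assoc, e₁, mul_assoc, e₂, mul_assoc]⟩
    refine Subgroup.closure_induction
      (p := fun x _ => (∀ h ∈ H, ∃ k' ∈ K ⊔ L, ∃ h' ∈ H, h * x = k' * h') ∧
        ∀ h ∈ H, ∃ k' ∈ K ⊔ L, ∃ h' ∈ H, h * x⁻¹ = k' * h') ?_ ?_ ?_ ?_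
      (show x ∈ Subgroup.closure ((K : Set G) ∪ L) by
        rwa [Subgroup.closure_union, Subgroup.closure_eq, Subgroup.closure_eq])
    · intro y hy
      exact ⟨gen y hy, gen y⁻¹ (hy.imp K.inv_mem L.inv_mem)⟩
    · exact ⟨fun h hh => ⟨1, one_mem _, h, hh, by simp⟩, fun h hh => ⟨1, one_mem _, h, hh, by simp⟩⟩
    · rintro x y - - ⟨hx, hx'⟩ ⟨hy, hy'⟩
      exact ⟨mul x y hx hy, by simpa only [mul_inv_rev] using mul _ _ hy' hx'⟩
    · rintro x - ⟨hx, hx'⟩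
      exact ⟨hx', by simpa only [inv_inv] using hx⟩
  exact permutes_iff.2 fun h hh x hx => (key x hx).1 h hh

theorem sup_left (hH : Permutes H L) (hK : Permutes K L) : Permutes (H ⊔ K) L :=
  (hH.symm.sup_right hK.symm).symm

theorem finset_sup_right {ι : Type*} {K : ι → Subgroup G} {s : Finset ι}
    (h : ∀ i ∈ s, Permutes H (K i)) : Permutes H (s.sup K) := by
  classical
  induction s using Finset.induction_on with
  | empty => exact (of_le bot_le : Permutes (⊥ : Subgroup G) H).symm
  | insert i s hi ih =>
    rw [Finset.sup_insert]
    exact (h i (by simp)).sup_right (ih fun j hj => h j (by simp [hj]))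

/-- Every coset of `H` in `HK = KH` has a representative in `K`. -/
theorem relIndex_sup (hp : Permutes H K) : H.relIndex (H ⊔ K) = H.relIndex K := by
  refine (Nat.card_congr (Equiv.ofBijective _
    ⟨(Subgroup.quotientSubgroupOfEmbeddingOfLE H (le_sup_right : K ≤ H ⊔ K)).injective, ?_⟩)).symm
  intro y
  induction y using QuotientGroup.induction_on with
  | _ z =>
    obtain ⟨z, hz⟩ := z
    obtain ⟨k, hk, h, hh, e⟩ := hp.symm.mem_sup.1 (by rwa [sup_comm])
    refine ⟨QuotientGroup.mk ⟨k, hk⟩, ?_⟩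
    rw [Subgroup.quotientSubgroupOfEmbeddingOfLE_apply_mk, QuotientGroup.eq]
    simpa [Subgroup.mem_subgroupOf, ← e] using hh

theorem card_sup_mul (hp : Permutes H K) :
    Nat.card (H ⊔ K : Subgroup G) = Nat.card H * H.relIndex K := by
  rw [← hp.relIndex_sup, mul_comm, ← Subgroup.relIndex_bot_left, ← Subgroup.relIndex_bot_left H,
    mul_comm, Subgroup.relIndex_mul_relIndex _ _ _ bot_le le_sup_left]

theorem map {G' : Type*} [Group G'] (f : G →* G') (hp : Permutes H K) :
    Permutes (H.map f) (K.map f) := by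
  unfold Permutes at *
  simp only [Subgroup.coe_map, ← Set.image_mul, hp]

theorem subgroupOf (hp : Permutes H K) (hH : H ≤ L) (hK : K ≤ L) :
    Permutes (H.subgroupOf L) (K.subgroupOf L) := by
  refine permutes_iff.2 fun h hh k hk => ?_
  obtain ⟨k', hk', h', hh', e⟩ := hp.exists_eq hh hk
  exact ⟨⟨k', hK hk'⟩, hk', ⟨h', hH hh'⟩, hh', Subtype.ext e⟩

end Permutes

namespace MutuallyPermutable

variable {A B : Subgroup G}

theorem symm (h : MutuallyPermutable A B) : MutuallyPermutable B A := ⟨h.2, h.1⟩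

theorem permutes (h : MutuallyPermutable A B) : Permutes A B := h.1 B le_rfl

theorem map {G' : Type*} [Group G'] (f : G →* G') (h : MutuallyPermutable A B) :
    MutuallyPermutable (A.map f) (B.map f) := by
  have key : ∀ {A B : Subgroup G}, (∀ K : Subgroup G, K ≤ B → Permutes A K) →
      ∀ K : Subgroup G', K ≤ B.map f → Permutes (A.map f) K := by
    intro A B h K hK
    have : K = (K.comap f ⊓ B).map f := by
      apply le_antisymm
      · intro x hx
        obtain ⟨b, hb, rfl⟩ := hK hx
        exact ⟨b, ⟨hx, hb⟩, rfl⟩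
      · rintro _ ⟨b, ⟨hb, -⟩, rfl⟩
        exact hb
    rw [this]
    exact (h _ inf_le_right).map f
  exact ⟨key h.1, key h.2⟩

theorem subgroupOf (h : MutuallyPermutable A B) (hA : A ≤ L) (hB : B ≤ L) :
    MutuallyPermutable (A.subgroupOf L) (B.subgroupOf L) := by
  have key : ∀ {A B : Subgroup G}, A ≤ L → B ≤ L → (∀ K : Subgroup G, K ≤ B → Permutes A K) →
      ∀ K : Subgroup L, K ≤ B.subgroupOf L → Permutes (A.subgroupOf L) K := by
    intro A B hA hB h K hK
    have hKB : K.map L.subtype ≤ B := by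
      rintro _ ⟨k, hk, rfl⟩
      exact hK hk
    have := (h _ hKB).subgroupOf hA (hKB.trans hB)
    rwa [Subgroup.subgroupOf, Subgroup.subgroupOf, Subgroup.comap_map_eq_self_of_injective
      L.subtype_injective] at this
  exact ⟨key hA hB h.1, key hB hA h.2⟩

/-- The intersection of two mutually permutable subgroups permutes with every subgroup of each. -/
theorem inf_permutes (h : MutuallyPermutable A B) {X : Subgroup G} (hX : X ≤ A) :
    Permutes (A ⊓ B) X := by
  refine permutes_iff.2 fun d hd x hx => ?_
  obtain ⟨x', hx', b, hb, e⟩ := (h.2 X hX).exists_eq hd.2 hx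
  refine ⟨x', hx', b, ⟨?_, hb⟩, e⟩
  have : b = x'⁻¹ * (d * x) := by rw [e]; group
  rw [this]
  exact A.mul_mem (A.inv_mem (hX hx')) (A.mul_mem hd.1 (hX hx))

/-- A subgroup between `A ⊓ B` and `A` is mutually permutable with `B`. -/
theorem of_inf_le (h : MutuallyPermutable A B) {C : Subgroup G} (hC : C ≤ A) (hD : A ⊓ B ≤ C) :
    MutuallyPermutable C B := by
  refine ⟨fun Y hY => ?_, fun X hX => h.2 X (hX.trans hC)⟩
  refine permutes_iff.2 fun c hc y hy => ?_
  -- `c * y = b * c'` and `c * y = y' * a`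
  obtain ⟨b, hb, c', hc', e⟩ := (h.2 C hC).symm.exists_eq hc (hY hy)
  obtain ⟨y', hy', a, ha, e'⟩ := (h.1 Y hY).exists_eq (hC hc) hy
  refine ⟨y', hy', a, ?_, e'⟩
  -- This element lies in both `A` and `B`, hence in `C`; so `a` lies in `C` too.
  have h1 : a * c'⁻¹ = y'⁻¹ * b := by
    have : b * c' = y' * a := e.symm.trans e'
    rw [eq_inv_mul_iff_mul_eq, ← mul_assoc, ← this]; group
  have h2 : a * c'⁻¹ ∈ A ⊓ B :=
    ⟨A.mul_mem ha (A.inv_mem (hC hc')), h1 ▸ B.mul_mem (B.inv_mem (hY hy')) hb⟩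
  have := mul_mem (hD h2) hc'
  simpa using this

end MutuallyPermutable

/-- A proper subgroup permuting with all subgroups of a finite group lies in a proper normal
subgroup. -/
theorem exists_normal_of_forall_permutes [Finite G] {D : Subgroup G} (hD : D ≠ ⊤)
    (hp : ∀ X : Subgroup G, Permutes D X) : ∃ M : Subgroup G, M.Normal ∧ D ≤ M ∧ M ≠ ⊤ := by
  obtain ⟨M, hDM, hM⟩ := (Set.toFinite {M : Subgroup G | M ≠ ⊤ ∧ ∀ X : Subgroup G,
    Permutes M X}).exists_le_maximal ⟨hD, hp⟩
  refine ⟨M, ⟨fun m hm a => ?_⟩, hDM, hM.1.1⟩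
  have hperm : ∀ X, Permutes (M.map (MulAut.conj a).toMonoidHom) X := by
    intro X
    have := (hM.1.2 (X.comap (MulAut.conj a).toMonoidHom)).map (MulAut.conj a).toMonoidHom
    rwa [Subgroup.map_comap_eq_self_of_surjective (MulAut.conj a).surjective] at this
  have hmem : a * m * a⁻¹ ∈ M.map (MulAut.conj a).toMonoidHom := ⟨m, hm, rfl⟩
  -- A group is never the product of a proper subgroup and a conjugate of it: writing `a` itself in
  -- `(aMa⁻¹)M` forces `a ∈ M`. Maximality of `M` then gives `aMa⁻¹ ≤ M`.
  have hsup : M.map (MulAut.conj a).toMonoidHom ⊔ M ≠ ⊤ := by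
    intro htop
    obtain ⟨_, ⟨m₁, hm₁, rfl⟩, m₂, hm₂, e⟩ := (hperm M).mem_sup.1 (htop ▸ Subgroup.mem_top a)
    have e' : a * m₁ * a⁻¹ * m₂ = a := e
    have ha : a = m₂ * m₁ := by
      have : m₁ * a⁻¹ * m₂ = 1 := by
        apply mul_left_cancel (a := a)
        rw [mul_one, ← mul_assoc, ← mul_assoc, e']
      have h2 : a⁻¹ = m₁⁻¹ * m₂⁻¹ := by
        rw [eq_inv_mul_iff_mul_eq, ← mul_eq_one_iff_eq_inv]; exact this
      rw [← inv_inv a, h2]; simp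
    have haM : a ∈ M := ha ▸ mul_mem hm₂ hm₁
    apply hM.1.1
    rw [← htop, eq_comm, sup_eq_right]
    rintro _ ⟨m, hm, rfl⟩
    exact mul_mem (mul_mem haM hm) (inv_mem haM)
  exact hM.2 ⟨hsup, fun X => (hperm X).sup_left (hM.1.2 X)⟩ le_sup_right
    (Subgroup.mem_sup_left hmem)

end Permutes

/-! ### Largest normal `π`-subgroups and the Baer–Suzuki theorem -/

section Cores

variable {G : Type*} [Group G]

theorem Permutes.of_normal (N K : Subgroup G) [hN : N.Normal] : Permutes N K :=
  permutes_iff.2 fun n hn k hk => ⟨k, hk, k⁻¹ * n * k, by simpa using hN.conj_mem n hn k⁻¹, by group⟩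

theorem primeDivs_mul (m n : ℕ) : primeDivs (m * n) = primeDivs m ∪ primeDivs n := by
  ext p
  simp only [primeDivs, Set.mem_ofPred_eq, Set.mem_union]
  constructor
  · rintro ⟨hp, h⟩
    exact (hp.dvd_mul.1 h).imp (fun h => ⟨hp, h⟩) fun h => ⟨hp, h⟩
  · rintro (⟨hp, h⟩ | ⟨hp, h⟩)
    exacts [⟨hp, h.mul_right _⟩, ⟨hp, h.mul_left _⟩]

theorem groupPrimes_mono {H K : Subgroup G} (h : H ≤ K) : groupPrimes H ⊆ groupPrimes K :=
  groupPrimes_subset_of_dvd (Subgroup.card_dvd_of_le h)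

theorem Permutes.groupPrimes_sup_subset {H K : Subgroup G} (hp : Permutes H K) :
    groupPrimes (H ⊔ K : Subgroup G) ⊆ groupPrimes H ∪ groupPrimes K := by
  unfold groupPrimes
  rw [hp.card_sup_mul, primeDivs_mul]
  exact Set.union_subset_union_right _ (groupPrimes_subset_of_dvd (Subgroup.relIndex_dvd_card _ _))

theorem isPGroup_iff_groupPrimes [Finite G] {p : ℕ} (hp : p.Prime) :
    IsPGroup p G ↔ groupPrimes G ⊆ {p} := by
  rw [isPGroup_iff_primeFactors_card_subset hp.ne_zero, hp.primeFactors]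
  constructor
  · intro h q hq
    simpa using h (Nat.mem_primeFactors.2 ⟨hq.1, hq.2, Nat.card_pos.ne'⟩)
  · intro h q hq
    have := h ⟨Nat.prime_of_mem_primeFactors hq, Nat.dvd_of_mem_primeFactors hq⟩
    simpa using this

theorem le_oPi {π : Set ℕ} {N : Subgroup G} [hN : N.Normal] (h : groupPrimes N ⊆ π) :
    N ≤ oPi π G := le_sSup ⟨hN, h⟩

theorem groupPrimes_oPi [Finite G] (π : Set ℕ) : groupPrimes (oPi π G) ⊆ π := by
  have hbot : (⊥ : Subgroup G).Normal ∧ groupPrimes (⊥ : Subgroup G) ⊆ π := by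
    refine ⟨inferInstance, fun p hp => ?_⟩
    have := hp.2
    rw [Subgroup.card_bot] at this
    exact absurd (Nat.dvd_one.1 this) hp.1.ne_one
  obtain ⟨M, -, hM⟩ := (Set.toFinite {N : Subgroup G | N.Normal ∧ groupPrimes N ⊆ π}).exists_le_maximal
    hbot
  have : oPi π G ≤ M := by
    refine sSup_le fun N hN => ?_
    have := hM.1.1
    have := hN.1
    have h : groupPrimes (M ⊔ N : Subgroup G) ⊆ π :=
      (Permutes.of_normal M N).groupPrimes_sup_subset.trans (Set.union_subset hM.1.2 hN.2)
    exact le_sup_right.trans (hM.2 ⟨inferInstance, h⟩ le_sup_left)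
  exact (groupPrimes_mono this).trans hM.1.2

theorem isPGroup_oPi [Finite G] {p : ℕ} (hp : p.Prime) : IsPGroup p (oPi {p} G) :=
  (isPGroup_iff_groupPrimes hp).2 (groupPrimes_oPi _)

theorem IsPGroup.le_oPi [Finite G] {p : ℕ} (hp : p.Prime) {N : Subgroup G} [N.Normal]
    (h : IsPGroup p N) : N ≤ oPi {p} G :=
  _root_.le_oPi ((isPGroup_iff_groupPrimes hp).1 h)

theorem mem_normalizer_of_forall_conj_mem [Finite G] {D : Subgroup G} {c : G}
    (h : ∀ d ∈ D, c * d * c⁻¹ ∈ D) : c ∈ Subgroup.normalizer (D : Set G) := by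
  rw [Subgroup.mem_normalizer_iff_map_conj_eq]
  apply Subgroup.eq_of_le_of_card_ge
  · rintro _ ⟨d, hd, rfl⟩
    exact h d hd
  · exact (Subgroup.card_map_of_injective (MulAut.conj c).injective).ge

/-- If a conjugacy-closed set `C` generates its trace `D` on a `p`-group `P` properly containing
that trace, then some element of `C ∩ P` outside `D` normalizes `D`. -/
theorem exists_mem_normalizing [Finite G] {p : ℕ} (hp : p.Prime) {C : Set G}
    (hC : ∀ c ∈ C, ∀ g : G, g * c * g⁻¹ ∈ C) {P D : Subgroup G} (hP : IsPGroup p P)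
    (hDP : D ≤ P) (hD : D = Subgroup.closure (C ∩ D)) (hne : ∃ c ∈ C, c ∈ P ∧ c ∉ D) :
    ∃ c ∈ C, c ∈ P ∧ c ∉ D ∧ ∀ d ∈ D, c * d * c⁻¹ ∈ D := by
  have : Fact p.Prime := ⟨hp⟩
  let N : Subgroup P := Subgroup.normalizer (D.subgroupOf P : Set P)
  have hmemN : ∀ x : P, x ∈ N → ∀ d ∈ D, (x : G) * d * (x : G)⁻¹ ∈ D := fun x hx d hd => by
    have := (Subgroup.mem_normalizer_iff.1 hx ⟨d, hDP hd⟩).1 hd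
    exact this
  by_cases hN : N = ⊤
  · obtain ⟨c, hc, hcP, hcD⟩ := hne
    exact ⟨c, hc, hcP, hcD, hmemN ⟨c, hcP⟩ (hN ▸ Subgroup.mem_top _)⟩
  · have hnil : Group.IsNilpotent P := hP.isNilpotent
    -- Normalizers grow in the nilpotent group `P`: some `g` normalizes `N` but not `D`, so it moves
    -- a generator of `D` out of `D` while keeping it in `N`.
    have hlt := Group.normalizerCondition_of_isNilpotent N (lt_top_iff_ne_top.2 hN)
    obtain ⟨g, hg, hgN⟩ := SetLike.exists_of_lt hlt
    have : ∃ c ∈ C ∩ (D : Set G), (g : G) * c * (g : G)⁻¹ ∉ D := by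
      by_contra! hcon
      apply hgN
      have hle : D ≤ D.comap (MulAut.conj (g : G)).toMonoidHom := by
        conv_lhs => rw [hD]
        rw [Subgroup.closure_le]
        exact fun c hc => hcon c hc
      exact mem_normalizer_of_forall_conj_mem (D := D.subgroupOf P) fun d hd => hle hd
    obtain ⟨c, ⟨hc, hcD⟩, hgc⟩ := this
    refine ⟨_, hC c hc g, P.mul_mem (P.mul_mem g.2 (hDP hcD)) (P.inv_mem g.2), hgc, ?_⟩
    have hcN : (⟨c, hDP hcD⟩ : P) ∈ N := Subgroup.le_normalizer (H := D.subgroupOf P) hcD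
    exact hmemN _ ((Subgroup.mem_normalizer_iff.1 hg _).1 hcN)

/-- The Baer–Suzuki theorem. -/
theorem mem_oPi_of_forall_conj [Finite G] {p : ℕ} (hp : p.Prime) {x : G}
    (h : ∀ g : G, ∃ Q : Subgroup G, IsPGroup p Q ∧ x ∈ Q ∧ g * x * g⁻¹ ∈ Q) :
    x ∈ oPi {p} G := by
  have : Fact p.Prime := ⟨hp⟩
  let C : Set G := {y | IsConj x y}
  have hC : ∀ c ∈ C, ∀ g : G, g * c * g⁻¹ ∈ C := fun c hc g =>
    IsConj.trans hc (isConj_iff.2 ⟨g, rfl⟩)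
  have hpair : ∀ a ∈ C, ∀ b ∈ C, ∃ Q : Subgroup G, IsPGroup p Q ∧ a ∈ Q ∧ b ∈ Q := by
    intro a ha b hb
    obtain ⟨u, rfl⟩ := isConj_iff.1 ha
    obtain ⟨v, rfl⟩ := isConj_iff.1 hb
    obtain ⟨Q, hQ, h1, h2⟩ := h (u⁻¹ * v)
    refine ⟨Q.map (MulAut.conj u).toMonoidHom, hQ.map _, ⟨x, h1, rfl⟩, ⟨_, h2, ?_⟩⟩
    simp only [MulEquiv.toMonoidHom_eq_coe, MonoidHom.coe_coe, MulAut.conj_apply]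
    group
  -- Sylow subgroups are conjugate, so their traces on the class `C` have the same size.
  have hcard : ∀ P Q : Sylow p G, C ∩ P ⊆ C ∩ Q → C ∩ (P : Set G) = C ∩ Q := by
    intro P Q hPQ
    obtain ⟨g, rfl⟩ := MulAction.exists_smul_eq G P Q
    apply Set.eq_of_subset_of_ncard_le hPQ _ (Set.toFinite _)
    have : C ∩ ((g • P : Sylow p G) : Set G) = (fun y => g * y * g⁻¹) '' (C ∩ P) := by
      ext y
      simp only [Set.mem_inter_iff, SetLike.mem_coe, Set.mem_image]
      constructor
      · rintro ⟨h1, h2⟩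
        rw [← SetLike.mem_coe, Sylow.coe_smul] at h2
        obtain ⟨z, hz, rfl⟩ := h2
        refine ⟨z, ⟨?_, hz⟩, rfl⟩
        have := hC _ h1 g⁻¹
        simpa [mul_assoc] using this
      · rintro ⟨z, ⟨h1, h2⟩, rfl⟩
        refine ⟨hC z h1 g, ?_⟩
        rw [← SetLike.mem_coe, Sylow.coe_smul]
        exact ⟨z, h2, rfl⟩
    rw [this]
    exact Set.ncard_image_le (Set.toFinite _)
  by_cases hall : ∀ P Q : Sylow p G, C ∩ (P : Set G) = C ∩ Q
  · have hCP : ∀ P : Sylow p G, C ⊆ P := by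
      intro P c hc
      obtain ⟨Q, hQ, hcQ, -⟩ := hpair c hc c hc
      obtain ⟨S, hS⟩ := hQ.exists_le_sylow
      have : c ∈ C ∩ (S : Set G) := ⟨hc, hS hcQ⟩
      rw [hall S P] at this
      exact this.2
    have hn : (Subgroup.normalClosure {x}) ≤ (default : Sylow p G) := by
      rw [Subgroup.normalClosure, Subgroup.closure_le]
      intro c hc
      obtain ⟨y, hy, hc⟩ := Group.mem_conjugatesOfSet_iff.1 hc
      rw [Set.mem_singleton_iff.1 hy] at hc
      exact hCP _ hc
    exact ((default : Sylow p G).2.to_le hn).le_oPi hp (Subgroup.subset_normalClosure rfl)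
  · exfalso
    push Not at hall
    obtain ⟨P₀, Q₀, hne₀⟩ := hall
    let S : Set (Sylow p G × Sylow p G) := {z | C ∩ (z.1 : Set G) ≠ C ∩ z.2}
    -- Among pairs of Sylow subgroups with different traces on `C`, take one with the largest common
    -- trace. A Sylow subgroup `R` containing that common trace and one further element of `C` from
    -- each of `P` and `Q` must then have the trace of both.
    obtain ⟨⟨P, Q⟩, hPQ, hmax⟩ := Set.exists_max_image S
      (fun z => (C ∩ z.1 ∩ z.2 : Set G).ncard) (Set.toFinite S) ⟨(P₀, Q₀), hne₀⟩
    have hPQ : C ∩ (P : Set G) ≠ C ∩ Q := hPQ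
    let D : Subgroup G := Subgroup.closure (C ∩ P ∩ Q)
    have hDP : D ≤ P := (Subgroup.closure_le _).2 fun c hc => hc.1.2
    have hDQ : D ≤ Q := (Subgroup.closure_le _).2 fun c hc => hc.2
    have hCD : C ∩ D = C ∩ P ∩ Q := Set.Subset.antisymm
      (fun c hc => ⟨⟨hc.1, hDP hc.2⟩, hDQ hc.2⟩) fun c hc => ⟨hc.1.1, Subgroup.subset_closure hc⟩
    have hD : D = Subgroup.closure (C ∩ D) := by rw [hCD]
    obtain ⟨c, hc, hcP, hcD, hcn⟩ := exists_mem_normalizing hp hC P.2 hDP hD (by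
      by_contra! hcon
      exact hPQ (hcard P Q fun c hc => ⟨hc.1, hDQ (hcon c hc.1 hc.2)⟩))
    obtain ⟨d, hd, hdQ, hdD, hdn⟩ := exists_mem_normalizing hp hC Q.2 hDQ hD (by
      by_contra! hcon
      exact hPQ (hcard Q P fun c hc => ⟨hc.1, hDP (hcon c hc.1 hc.2)⟩).symm)
    obtain ⟨T, hT, hcT, hdT⟩ := hpair c hc d hd
    let U : Subgroup G := Subgroup.closure {c, d}
    have hUT : U ≤ T := (Subgroup.closure_le _).2 (by
      rintro y (rfl | rfl)
      exacts [hcT, hdT])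
    have hUn : U ≤ Subgroup.normalizer (D : Set G) := (Subgroup.closure_le _).2 (by
      rintro y (rfl | rfl)
      exacts [mem_normalizer_of_forall_conj_mem hcn, mem_normalizer_of_forall_conj_mem hdn])
    have hUD : IsPGroup p (U ⊔ D : Subgroup G) :=
      (hT.to_le hUT).to_sup_of_normal_right' (P.2.to_le hDP) hUn
    obtain ⟨R, hR⟩ := hUD.exists_le_sylow
    have hcR : c ∈ R := hR (Subgroup.mem_sup_left (Subgroup.subset_closure (by simp)))
    have hdR : d ∈ R := hR (Subgroup.mem_sup_left (Subgroup.subset_closure (by simp)))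
    have hDR : D ≤ R := le_sup_right.trans hR
    have key : ∀ (P' : Sylow p G) (c : G), c ∈ C → c ∈ P' → c ∈ R → c ∉ D → D ≤ P' →
        C ∩ (P' : Set G) = C ∩ R := by
      intro P' c hc hcP hcR hcD hDP'
      by_contra hne
      have := hmax (P', R) hne
      refine absurd this (not_le.2 (Set.ncard_lt_ncard ?_ (Set.toFinite _)))
      rw [Set.ssubset_iff_of_subset]
      · exact ⟨c, ⟨⟨hc, hcP⟩, hcR⟩, fun h => hcD (Subgroup.subset_closure h)⟩
      · intro z hz
        have hzD : z ∈ D := Subgroup.subset_closure hz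
        exact ⟨⟨hz.1.1, hDP' hzD⟩, hDR hzD⟩
    exact hPQ ((key P c hc hcP hcR hcD hDP).trans (key Q d hd hdQ hdR hdD hDQ).symm)

end Cores

/-! ### The `p`-cores of subgroups and of their products -/

/-- `O_p(L)` for a subgroup `L`, as a subgroup of the ambient group. -/
def coreIn {G : Type*} [Group G] (p : ℕ) (L : Subgroup G) : Subgroup G :=
  (oPi {p} L).map L.subtype

section CoreIn

variable {G : Type*} [Group G] {p : ℕ}

theorem coreIn_le (p : ℕ) (L : Subgroup G) : coreIn p L ≤ L := by
  rintro _ ⟨x, -, rfl⟩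
  exact x.2

theorem isPGroup_coreIn [Finite G] (hp : p.Prime) (L : Subgroup G) : IsPGroup p (coreIn p L) :=
  (isPGroup_oPi hp).map _

theorem conj_mem_coreIn {L : Subgroup G} {g x : G} (hg : g ∈ L) (hx : x ∈ coreIn p L) :
    g * x * g⁻¹ ∈ coreIn p L := by
  obtain ⟨y, hy, rfl⟩ := hx
  exact ⟨⟨g, hg⟩ * y * ⟨g, hg⟩⁻¹, (oPi_normal _ _).conj_mem y hy ⟨g, hg⟩, rfl⟩

theorem le_coreIn [Finite G] (hp : p.Prime) {L N : Subgroup G} (hNL : N ≤ L) (hN : IsPGroup p N)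
    (h : ∀ g ∈ L, ∀ x ∈ N, g * x * g⁻¹ ∈ N) : N ≤ coreIn p L := by
  have : (N.subgroupOf L).Normal := ⟨fun x hx g => h g g.2 x hx⟩
  have hle : N.subgroupOf L ≤ oPi {p} L := IsPGroup.le_oPi hp hN.comap_subtype
  exact fun x hx => ⟨⟨x, hNL hx⟩, hle hx, rfl⟩

theorem mem_coreIn_of_forall_conj [Finite G] (hp : p.Prime) {L : Subgroup G} {x : G} (hx : x ∈ L)
    (h : ∀ g ∈ L, ∃ Q : Subgroup G, IsPGroup p Q ∧ x ∈ Q ∧ g * x * g⁻¹ ∈ Q) :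
    x ∈ coreIn p L := by
  refine ⟨⟨x, hx⟩, mem_oPi_of_forall_conj hp fun g => ?_, rfl⟩
  obtain ⟨Q, hQ, h1, h2⟩ := h g g.2
  exact ⟨Q.comap L.subtype, hQ.comap_subtype, h1, h2⟩

theorem conj_mem_coreIn_of_normalized [Finite G] (hp : p.Prime) {K : Subgroup G} {g x : G}
    (hg : ∀ y ∈ K, g * y * g⁻¹ ∈ K) (hx : x ∈ coreIn p K) : g * x * g⁻¹ ∈ coreIn p K := by
  have hg' : ∀ y ∈ K, g⁻¹ * y * g ∈ K := fun y =>
    (Subgroup.mem_normalizer_iff''.1 (mem_normalizer_of_forall_conj_mem hg) y).1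
  refine le_coreIn hp (N := (coreIn p K).map (MulAut.conj g).toMonoidHom) ?_
    ((isPGroup_coreIn hp K).map _) ?_ ⟨x, hx, rfl⟩
  · rintro _ ⟨y, hy, rfl⟩
    exact hg y (coreIn_le p K hy)
  · rintro k hk _ ⟨y, hy, rfl⟩
    refine ⟨_, conj_mem_coreIn (hg' k hk) hy, ?_⟩
    simp only [MulEquiv.toMonoidHom_eq_coe, MonoidHom.coe_coe, MulAut.conj_apply]
    group

theorem coreIn_le_coreIn [Finite G] (hp : p.Prime) {K L : Subgroup G} (hKL : K ≤ L)
    (h : ∀ g ∈ L, ∀ x ∈ K, g * x * g⁻¹ ∈ K) : coreIn p K ≤ coreIn p L :=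
  le_coreIn hp ((coreIn_le p K).trans hKL) (isPGroup_coreIn hp K) fun g hg _ hx =>
    conj_mem_coreIn_of_normalized hp (h g hg) hx

theorem coreIn_top_le_oPi [Finite G] (hp : p.Prime) : coreIn p (⊤ : Subgroup G) ≤ oPi {p} G := by
  have : (coreIn p (⊤ : Subgroup G)).Normal := ⟨fun _ hx g => conj_mem_coreIn (Subgroup.mem_top g) hx⟩
  exact (isPGroup_coreIn hp ⊤).le_oPi hp

theorem mem_coreIn_of_le [Finite G] (hp : p.Prime) {K L : Subgroup G} (hKL : K ≤ L) {x : G}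
    (hx : x ∈ coreIn p L) (hxK : x ∈ K) : x ∈ coreIn p K :=
  le_coreIn hp (N := coreIn p L ⊓ K) inf_le_right ((isPGroup_coreIn hp L).to_le inf_le_left)
    (fun _ hg _ hy => ⟨conj_mem_coreIn (hKL hg) hy.1,
      K.mul_mem (K.mul_mem hg hy.2) (K.inv_mem hg)⟩) ⟨hx, hxK⟩

/-- In a product of two subgroups the `p`-cores of the factors intersect in the `p`-core. -/
theorem Permutes.mem_coreIn_sup [Finite G] (hp : p.Prime) {A B : Subgroup G} (hAB : Permutes A B)
    {x : G} (hA : x ∈ coreIn p A) (hB : x ∈ coreIn p B) : x ∈ coreIn p (A ⊔ B) := by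
  have : Fact p.Prime := ⟨hp⟩
  -- `coreIn p A` and `coreIn p B` lie in a common Sylow subgroup of `A ⊔ B`
  have hcommon : ∃ Q : Subgroup G, IsPGroup p Q ∧ coreIn p A ≤ Q ∧ coreIn p B ≤ Q := by
    have hA' : IsPGroup p ((coreIn p A).subgroupOf (A ⊔ B)) := (isPGroup_coreIn hp A).comap_subtype
    have hB' : IsPGroup p ((coreIn p B).subgroupOf (A ⊔ B)) := (isPGroup_coreIn hp B).comap_subtype
    obtain ⟨P, hP⟩ := hA'.exists_le_sylow
    obtain ⟨Q, hQ⟩ := hB'.exists_le_sylow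
    obtain ⟨g, rfl⟩ := MulAction.exists_smul_eq (A ⊔ B : Subgroup G) P Q
    obtain ⟨b, hb, a, ha, e⟩ := hAB.symm.mem_sup.1 (by rw [sup_comm]; exact g.2)
    let α : (A ⊔ B : Subgroup G) := ⟨a, Subgroup.mem_sup_left ha⟩
    let β : (A ⊔ B : Subgroup G) := ⟨b, Subgroup.mem_sup_right hb⟩
    have hg : g = β * α := Subtype.ext e.symm
    refine ⟨((α • P : Sylow p (A ⊔ B : Subgroup G)) : Subgroup (A ⊔ B : Subgroup G)).map
      (A ⊔ B).subtype, (α • P).2.map _, fun y hy => ?_, fun y hy => ?_⟩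
    · refine ⟨⟨y, Subgroup.mem_sup_left (coreIn_le p A hy)⟩, ?_, rfl⟩
      have hy' : a⁻¹ * y * a⁻¹⁻¹ ∈ coreIn p A := conj_mem_coreIn (A.inv_mem ha) hy
      have hmem := hP (show (⟨_, Subgroup.mem_sup_left (coreIn_le p A hy')⟩ :
        (A ⊔ B : Subgroup G)) ∈ (coreIn p A).subgroupOf (A ⊔ B) from hy')
      refine Set.mem_smul_set.2 ⟨_, hmem, Subtype.ext ?_⟩
      change a * (a⁻¹ * y * a⁻¹⁻¹) * a⁻¹ = y
      group
    · refine ⟨⟨y, Subgroup.mem_sup_right (coreIn_le p B hy)⟩, ?_, rfl⟩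
      have hy' : b * y * b⁻¹ ∈ coreIn p B := conj_mem_coreIn hb hy
      have hmem := hQ (show (⟨_, Subgroup.mem_sup_right (coreIn_le p B hy')⟩ :
        (A ⊔ B : Subgroup G)) ∈ (coreIn p B).subgroupOf (A ⊔ B) from hy')
      rw [hg, mul_smul] at hmem
      obtain ⟨z, hz, hz'⟩ := Set.mem_smul_set.1 hmem
      have e1 : b * (z : G) * b⁻¹ = b * y * b⁻¹ := congrArg Subtype.val hz'
      have e2 : (z : G) = y := by simpa using e1
      have e3 : z = ⟨y, Subgroup.mem_sup_right (coreIn_le p B hy)⟩ := Subtype.ext e2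
      exact e3 ▸ hz
  obtain ⟨Q, hQ, hAQ, hBQ⟩ := hcommon
  refine mem_coreIn_of_forall_conj hp (Subgroup.mem_sup_left (coreIn_le p A hA)) fun g hg => ?_
  obtain ⟨b, hb, a, ha, rfl⟩ := hAB.symm.mem_sup.1 (by rwa [sup_comm])
  -- For `g = ba`, both `b⁻¹xb ∈ O_p(B)` and `axa⁻¹ ∈ O_p(A)` lie in `Q`; conjugation by `b` gives
  -- `x` and `gxg⁻¹`.
  refine ⟨Q.map (MulAut.conj b).toMonoidHom, hQ.map _, ?_, ?_⟩
  · refine ⟨_, hBQ (conj_mem_coreIn (B.inv_mem hb) hB), ?_⟩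
    simp only [MulEquiv.toMonoidHom_eq_coe, MonoidHom.coe_coe, MulAut.conj_apply]
    group
  · refine ⟨_, hAQ (conj_mem_coreIn ha hA), ?_⟩
    simp only [MulEquiv.toMonoidHom_eq_coe, MonoidHom.coe_coe, MulAut.conj_apply]
    group

/-- Factors are added one at a time. Keeping `H i` in both halves of the product leaves `x` in the
`p`-core of each half, so that `Permutes.mem_coreIn_sup` applies. -/
theorem mem_coreIn_finset_sup [Finite G] (hp : p.Prime) {ι : Type*} {H : ι → Subgroup G}
    (hH : ∀ i j, Permutes (H i) (H j)) (i : ι) {x : G} (hx : x ∈ coreIn p (H i))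
    (h : ∀ j, x ∈ coreIn p (H i ⊔ H j)) (s : Finset ι) : x ∈ coreIn p (H i ⊔ s.sup H) := by
  classical
  induction s using Finset.induction_on with
  | empty => simpa using hx
  | insert j s hj ih =>
    have e : H i ⊔ (insert j s).sup H = (H i ⊔ H j) ⊔ (H i ⊔ s.sup H) := by
      rw [Finset.sup_insert, ← sup_sup_distrib_left]
    have hs : ∀ k, Permutes (H k) (s.sup H) := fun k => Permutes.finset_sup_right fun l _ => hH k l
    rw [e]
    exact Permutes.mem_coreIn_sup hp (Permutes.sup_left ((Permutes.refl _).sup_right (hs i))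
      ((hH j i).sup_right (hs j))) (h j) ih

end CoreIn

/-! ### Subgroups of prime index in soluble groups -/

section Solvable

variable {G : Type*} [Group G]

theorem isSolvable_of_le {H K : Subgroup G} (h : H ≤ K) [Group.IsSolvable K] :
    Group.IsSolvable H :=
  Group.isSolvable_of_isSolvable_injective (Subgroup.inclusion_injective h)

theorem isSolvable_map {G' : Type*} [Group G'] (f : G →* G') (H : Subgroup G)
    [Group.IsSolvable H] : Group.IsSolvable (H.map f) :=
  Group.isSolvable_of_surjective (f.subgroupMap_surjective H)

theorem isSolvable_subgroupOf {H K : Subgroup G} (h : H ≤ K) [Group.IsSolvable H] :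
    Group.IsSolvable (H.subgroupOf K) :=
  Group.isSolvable_of_isSolvable_injective (f := (Subgroup.subgroupOfEquivOfLe h).toMonoidHom)
    (Subgroup.subgroupOfEquivOfLe h).injective

theorem subgroupOf_sup_eq_top {A B L : Subgroup G} (h : A ⊔ B = L) :
    A.subgroupOf L ⊔ B.subgroupOf L = ⊤ := by
  have hA : A ≤ L := h ▸ le_sup_left
  have hB : B ≤ L := h ▸ le_sup_right
  rw [← Subgroup.subgroupOf_sup hA hB, h, Subgroup.subgroupOf_self]

/-- A proper subgroup of a finite soluble group permuting with all subgroups lies in a subgroup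
of prime index. -/
theorem exists_prime_index_of_forall_permutes [Finite G] [Group.IsSolvable G] {D : Subgroup G}
    (hD : D ≠ ⊤) (hp : ∀ X : Subgroup G, Permutes D X) :
    ∃ C : Subgroup G, D ≤ C ∧ C.index.Prime := by
  obtain ⟨M, hMn, hDM, hM⟩ := exists_normal_of_forall_permutes hD hp
  have hnt : Nontrivial (G ⧸ M) := QuotientGroup.nontrivial_iff.2 hM
  -- A maximal subgroup above the derived subgroup of `G ⧸ M` is normal with simple abelian
  -- quotient, so its index is prime.
  have hlt := Group.IsSolvable.commutator_lt_top_of_nontrivial (G ⧸ M)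
  obtain ⟨C, hC, hle⟩ := (eq_top_or_exists_le_coatom (commutator (G ⧸ M))).resolve_left hlt.ne
  have hCn : C.Normal := ⟨fun c hc g => by
    have : g * c * g⁻¹ * c⁻¹ ∈ C := hle (Subgroup.commutator_mem_commutator (Subgroup.mem_top g)
      (Subgroup.mem_top c))
    simpa using C.mul_mem this hc⟩
  have hcomm : ∀ a b : (G ⧸ M) ⧸ C, a * b = b * a := by
    intro a b
    induction a using QuotientGroup.induction_on with
    | _ a =>
    induction b using QuotientGroup.induction_on with
    | _ b =>
    rw [← QuotientGroup.mk_mul, ← QuotientGroup.mk_mul, QuotientGroup.eq]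
    have : b⁻¹ * a⁻¹ * b * a ∈ C := by
      simpa [commutatorElement_def] using hle (Subgroup.commutator_mem_commutator
        (Subgroup.mem_top b⁻¹) (Subgroup.mem_top a⁻¹))
    simpa [mul_assoc] using this
  have : Nontrivial ((G ⧸ M) ⧸ C) := QuotientGroup.nontrivial_iff.2 hC.1
  have hsimple : IsSimpleGroup ((G ⧸ M) ⧸ C) := ⟨fun N _ => by
    have hCN : C ≤ N.comap (QuotientGroup.mk' C) := by
      intro c hc
      have : QuotientGroup.mk' C c = 1 := (QuotientGroup.eq_one_iff c).2 hc
      rw [Subgroup.mem_comap, this]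
      exact N.one_mem
    have hmap := Subgroup.map_comap_eq_self_of_surjective (QuotientGroup.mk'_surjective C) N
    rcases hC.le_iff.1 hCN with h | h
    · right
      rw [← hmap, h, Subgroup.map_top_of_surjective _ (QuotientGroup.mk'_surjective C)]
    · left
      rw [← hmap, h, QuotientGroup.map_mk'_self]⟩
  have : IsMulCommutative ((G ⧸ M) ⧸ C) := ⟨⟨hcomm⟩⟩
  refine ⟨C.comap (QuotientGroup.mk' M), fun d hd => ?_, ?_⟩
  · have : QuotientGroup.mk' M d = 1 := (QuotientGroup.eq_one_iff d).2 (hDM hd)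
    rw [Subgroup.mem_comap, this]
    exact C.one_mem
  · rw [Subgroup.index_comap_of_surjective _ (QuotientGroup.mk'_surjective M)]
    exact Group.is_simple_iff_prime_card.1 hsimple

end Solvable

/-! ### Solubility of a product of two factors -/

section TwoFactors

universe u

/-- Solubility of mutually permutable products of two soluble groups, in orders below `n`. -/
def SolvableProductsBelow (n : ℕ) : Prop :=
  ∀ (G : Type u) [Group G] [Finite G], Nat.card G < n → ∀ A B : Subgroup G,
    MutuallyPermutable A B → A ⊔ B = ⊤ → Group.IsSolvable A → Group.IsSolvable B →
    Group.IsSolvable G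

/-- As `A ⊓ B` permutes with all subgroups of `A`, it lies in some `C` of prime index `t` in `A`.
The subgroup `CB` has index `t` in `G` and is soluble by induction. If its core is nontrivial,
induction applies to the quotient; otherwise `G` acts faithfully on `t` cosets. -/
theorem solvable_or_card_dvd_factorial {G : Type u} [Group G] [Finite G]
    (ih : SolvableProductsBelow.{u} (Nat.card G)) {A B : Subgroup G}
    (h : MutuallyPermutable A B) (htop : A ⊔ B = ⊤) (hA : Group.IsSolvable A)
    (hB : Group.IsSolvable B) (hAB : ¬ A ≤ B) :
    Group.IsSolvable G ∨ ∃ t : ℕ, t.Prime ∧ Nat.card G ∣ t.factorial ∧ t ∣ Nat.card A ∧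
      ∃ M : Subgroup G, M.index = t ∧ B ≤ M := by
  have hD : (A ⊓ B).subgroupOf A ≠ ⊤ := by
    rw [Ne, Subgroup.subgroupOf_eq_top]
    exact fun hle => hAB (hle.trans inf_le_right)
  obtain ⟨C', hDC', ht⟩ := exists_prime_index_of_forall_permutes hD fun X => by
    have hX : X.map A.subtype ≤ A := by
      rintro _ ⟨k, hk, rfl⟩
      exact k.2
    have := (h.inf_permutes hX).subgroupOf inf_le_left hX
    rwa [Subgroup.subgroupOf, Subgroup.subgroupOf, Subgroup.comap_map_eq_self_of_injective
      A.subtype_injective] at this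
  set C : Subgroup G := C'.map A.subtype with hCdef
  have hCA : C ≤ A := by
    rintro _ ⟨k, hk, rfl⟩
    exact k.2
  have hDC : A ⊓ B ≤ C := fun x hx => ⟨⟨x, hx.1⟩, hDC' hx, rfl⟩
  have hCsub : C.subgroupOf A = C' := Subgroup.comap_map_eq_self_of_injective
    A.subtype_injective C'
  have hCB := h.of_inf_le hCA hDC
  have hinf : (C ⊔ B) ⊓ A = C := by
    apply le_antisymm
    · rintro x ⟨hx, hxA⟩
      obtain ⟨c, hc, b, hb, rfl⟩ := hCB.permutes.mem_sup.1 hx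
      have : b ∈ A := by simpa using A.mul_mem (A.inv_mem (hCA hc)) hxA
      exact C.mul_mem hc (hDC ⟨this, hb⟩)
    · exact le_inf le_sup_left hCA
  have hindex : (C ⊔ B).index = C'.index := by
    have hperm : Permutes (C ⊔ B) A := (Permutes.of_le hCA).sup_left h.permutes.symm
    have : (C ⊔ B) ⊔ A = ⊤ := by
      rw [eq_top_iff, ← htop]
      exact sup_le le_sup_right (le_sup_right.trans le_sup_left)
    rw [← Subgroup.relIndex_top_right, ← this, hperm.relIndex_sup, ← Subgroup.inf_relIndex_right,
      hinf, Subgroup.relIndex, hCsub]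
  have hMlt : Nat.card (C ⊔ B : Subgroup G) < Nat.card G := by
    apply lt_of_le_of_ne (Subgroup.card_le_card_group _)
    intro he
    have := Subgroup.eq_top_of_card_eq _ he
    rw [this, Subgroup.index_top] at hindex
    exact ht.ne_one hindex.symm
  have hMsol : Group.IsSolvable (C ⊔ B : Subgroup G) :=
    have := isSolvable_of_le hCA
    ih _ hMlt _ _ (hCB.subgroupOf le_sup_left le_sup_right) (subgroupOf_sup_eq_top rfl)
      (isSolvable_subgroupOf le_sup_left) (isSolvable_subgroupOf le_sup_right)
  by_cases hK : (C ⊔ B).normalCore = ⊥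
  · right
    refine ⟨_, ht, ?_, ?_, C ⊔ B, hindex, le_sup_right⟩
    · rw [Subgroup.normalCore_eq_ker] at hK
      have := Subgroup.card_dvd_of_injective _ ((MonoidHom.ker_eq_bot_iff _).1 hK)
      rwa [Nat.card_perm, ← Subgroup.index_eq_card, hindex] at this
    · exact C'.index_dvd_card
  · left
    have hKsol : Group.IsSolvable (C ⊔ B).normalCore := isSolvable_of_le (Subgroup.normalCore_le _)
    have hlt : Nat.card (G ⧸ (C ⊔ B).normalCore) < Nat.card G := by
      rw [← Subgroup.card_mul_index (C ⊔ B).normalCore, Subgroup.index_eq_card]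
      exact lt_mul_left Nat.card_pos (Subgroup.one_lt_card_iff_ne_bot _ |>.2 hK)
    rw [Group.isSolvable_iff_subgroup_quotient (C ⊔ B).normalCore]
    refine ⟨hKsol, ih _ hlt _ _ (h.map (QuotientGroup.mk' _)) ?_ (isSolvable_map _ _)
      (isSolvable_map _ _)⟩
    rw [← Subgroup.map_sup, htop, Subgroup.map_top_of_surjective _ (QuotientGroup.mk'_surjective _)]

theorem solvableProductsBelow (n : ℕ) : SolvableProductsBelow.{u} n := by
  induction n with
  | zero => exact fun G _ _ h => absurd h (Nat.not_lt_zero _)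
  | succ n ih =>
    intro G _ _ hlt A B h htop hA hB
    replace ih : SolvableProductsBelow.{u} (Nat.card G) :=
      fun G' _ _ hlt' => ih G' (hlt'.trans_le (Nat.lt_succ_iff.1 hlt))
    have hAle : A ≤ B → Group.IsSolvable G := fun hle => by
      rw [sup_eq_right.2 hle] at htop
      rw [htop] at hB
      exact Group.isSolvable_of_surjective (f := (⊤ : Subgroup G).subtype) fun x => ⟨⟨x, trivial⟩, rfl⟩
    have hBle : B ≤ A → Group.IsSolvable G := fun hle => by
      rw [sup_eq_left.2 hle] at htop
      rw [htop] at hA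
      exact Group.isSolvable_of_surjective (f := (⊤ : Subgroup G).subtype) fun x => ⟨⟨x, trivial⟩, rfl⟩
    by_cases h1 : A ≤ B
    · exact hAle h1
    by_cases h2 : B ≤ A
    · exact hBle h2
    obtain hs | ⟨t, ht, hGt, htA, M, hM, hBM⟩ := solvable_or_card_dvd_factorial ih h htop hA hB h1
    · exact hs
    obtain hs | ⟨s, hs, hGs, hsB, -⟩ := solvable_or_card_dvd_factorial ih h.symm
      (by rwa [sup_comm]) hB hA h2
    · exact hs
    exfalso
    have hst : s ≤ t := (hs.dvd_factorial).1 ((hsB.trans B.card_subgroup_dvd_card).trans hGt)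
    have hts : t ≤ s := (ht.dvd_factorial).1 ((htA.trans A.card_subgroup_dvd_card).trans hGs)
    obtain rfl : s = t := le_antisymm hst hts
    -- One factor `s` comes from `|B|`, which divides `|M|`, the other from the index of `M`; but
    -- the square of a prime `s` does not divide `s!`.
    have hsq : s * s ∣ s.factorial := by
      refine dvd_trans ?_ hGt
      rw [← Subgroup.card_mul_index M, hM]
      exact Nat.mul_dvd_mul (hsB.trans (Subgroup.card_dvd_of_le hBM)) dvd_rfl
    rw [← Nat.mul_factorial_pred hs.ne_zero] at hsq
    have := (hs.dvd_factorial).1 (Nat.dvd_of_mul_dvd_mul_left hs.pos hsq)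
    have := hs.pos
    omega

theorem MutuallyPermutable.isSolvable_sup {G : Type u} [Group G] [Finite G] {A B : Subgroup G}
    (h : MutuallyPermutable A B) (hA : Group.IsSolvable A) (hB : Group.IsSolvable B) :
    Group.IsSolvable (A ⊔ B : Subgroup G) :=
  solvableProductsBelow _ _ (Nat.lt_succ_self _) _ _ (h.subgroupOf le_sup_left le_sup_right)
    (subgroupOf_sup_eq_top rfl) (isSolvable_subgroupOf le_sup_left)
    (isSolvable_subgroupOf le_sup_right)

end TwoFactors

/-! ### Cores of subgroups of prime index, and `O_r` of a product of two factors -/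

section PrimeIndex

variable {G : Type*} [Group G] [Finite G]

theorem exists_abelian_normal_le [Group.IsSolvable G] {N : Subgroup G} [N.Normal] (hN : N ≠ ⊥) :
    ∃ M : Subgroup G, M.Normal ∧ M ≤ N ∧ M ≠ ⊥ ∧ ∀ a ∈ M, ∀ b ∈ M, a * b = b * a := by
  obtain ⟨M, hMN, hM⟩ := (Set.toFinite {M : Subgroup G | M.Normal ∧ M ≠ ⊥}).exists_le_minimal
    ⟨‹N.Normal›, hN⟩
  have hMn := hM.1.1
  have hlt := Group.IsSolvable.commutator_lt_of_ne_bot hM.1.2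
  have hbot : ⁅M, M⁆ = ⊥ := by
    by_contra hne
    exact hlt.not_ge (hM.2 ⟨inferInstance, hne⟩ hlt.le)
  refine ⟨M, hMn, hMN, hM.1.2, fun a ha b hb => ?_⟩
  exact (Subgroup.mem_centralizer_iff.1
    (Subgroup.commutator_eq_bot_iff_le_centralizer.1 hbot ha) b hb).symm

theorem exists_mem_oPi_of_normal [Group.IsSolvable G] {N : Subgroup G} [N.Normal] (hN : N ≠ ⊥) :
    ∃ r : ℕ, r.Prime ∧ ∃ x ∈ N, x ∈ oPi {r} G ∧ x ≠ 1 := by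
  obtain ⟨M, hMn, hMN, hM, hcomm⟩ := exists_abelian_normal_le hN
  obtain ⟨r, hr, hdvd⟩ := Nat.exists_prime_and_dvd ((Subgroup.card_eq_one).not.2 hM)
  have : Fact r.Prime := ⟨hr⟩
  obtain ⟨x, hx⟩ := exists_prime_orderOf_dvd_card' r hdvd
  -- The elements of exponent `r` in the abelian normal subgroup `M` form a normal `r`-subgroup.
  let T : Subgroup G :=
    { carrier := {y | y ∈ M ∧ y ^ r = 1}
      one_mem' := ⟨M.one_mem, one_pow r⟩
      mul_mem' := fun {a b} ha hb => ⟨M.mul_mem ha.1 hb.1, by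
        rw [Commute.mul_pow (hcomm a ha.1 b hb.1), ha.2, hb.2, one_mul]⟩
      inv_mem' := fun {a} ha => ⟨M.inv_mem ha.1, by rw [inv_pow, ha.2, inv_one]⟩ }
  have hTn : T.Normal := ⟨fun y hy g => ⟨hMn.conj_mem y hy.1 g, by rw [conj_pow, hy.2]; group⟩⟩
  have hT : IsPGroup r T := isPGroup_iff_pow_pow_eq_one.2 fun y =>
    ⟨1, Subtype.ext (by simpa using y.2.2)⟩
  refine ⟨r, hr, x, hMN x.2, hT.le_oPi hr ⟨x.2, ?_⟩, fun h1 => ?_⟩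
  · rw [← hx]
    exact congrArg Subtype.val (pow_orderOf_eq_one x)
  · rw [(Subtype.ext h1 : x = 1), orderOf_one] at hx
    exact hr.one_lt.ne hx

theorem mulAut_mul_comm {M : Type*} [Group M] [IsCyclic M] (a b : MulAut M) : a * b = b * a :=
  (IsCyclic.mulAutMulEquiv M).injective (by rw [map_mul, map_mul, mul_comm])

/-- A core-free subgroup of prime index `s` in a finite soluble group is abelian and acts
faithfully on a normal subgroup of order `s`. -/
theorem eq_one_of_coreFree [Group.IsSolvable G] {A : Subgroup G} (hA : A.index.Prime)
    (hcore : ∀ N : Subgroup G, N.Normal → N ≤ A → N = ⊥) {a : G} (ha : a ∈ A)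
    (h : a ∈ ⁅A, A⁆ ∨ (orderOf a).Coprime (A.index - 1)) : a = 1 := by
  have hne : (⊤ : Subgroup G) ≠ ⊥ := by
    intro h
    have : A = ⊤ := top_le_iff.1 (h ▸ bot_le)
    rw [this, Subgroup.index_top] at hA
    exact Nat.not_prime_one hA
  obtain ⟨M, hMn, -, hM, hcomm⟩ := exists_abelian_normal_le hne
  have hsup : A ⊔ M = ⊤ := by
    rcases (Nat.dvd_prime hA).1 (Subgroup.index_dvd_of_le (le_sup_left : A ≤ A ⊔ M)) with h1 | h1
    · exact Subgroup.index_eq_one.1 h1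
    · exfalso
      have h2 := Subgroup.relIndex_mul_index (le_sup_left : A ≤ A ⊔ M)
      rw [h1] at h2
      have h3 : A.relIndex (A ⊔ M) = 1 := Nat.eq_of_mul_eq_mul_right hA.pos (by rw [h2, one_mul])
      exact hM (hcore M hMn (le_sup_right.trans (Subgroup.relIndex_eq_one.1 h3)))
  have hperm : Permutes A M := (Permutes.of_normal M A).symm
  have normal_of : ∀ N : Subgroup G, (∀ g ∈ A, ∀ x ∈ N, g * x * g⁻¹ ∈ N) →
      (∀ g ∈ M, ∀ x ∈ N, g * x * g⁻¹ ∈ N) → N.Normal := by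
    intro N h1 h2
    refine ⟨fun x hx g => ?_⟩
    obtain ⟨u, hu, v, hv, rfl⟩ := hperm.mem_sup.1 (hsup ▸ Subgroup.mem_top g)
    have := h1 u hu _ (h2 v hv x hx)
    simpa [mul_assoc] using this
  -- `A ⊓ M` is normalized by `A` and, `M` being abelian, centralized by `M`; it is thus a normal
  -- subgroup inside the core-free `A`.
  have hinf : A ⊓ M = ⊥ := by
    refine hcore _ (normal_of _ (fun g hg x hx => ⟨A.mul_mem (A.mul_mem hg hx.1) (A.inv_mem hg),
      hMn.conj_mem x hx.2 g⟩) fun g hg x hx => ?_) inf_le_left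
    rwa [hcomm g hg x hx.2, mul_inv_cancel_right]
  have hcard : Nat.card M = A.index := by
    rw [← Subgroup.relIndex_top_right, ← hsup, hperm.relIndex_sup, ← Subgroup.inf_relIndex_right,
      hinf, Subgroup.relIndex_bot_left]
  have hfaith : ∀ a ∈ A, MulAut.conjNormal (H := M) a = 1 → a = 1 := by
    intro a ha h1
    have hZ : A ⊓ Subgroup.centralizer M = ⊥ := by
      refine hcore _ (normal_of _ (fun g hg x hx => ⟨A.mul_mem (A.mul_mem hg hx.1) (A.inv_mem hg),
        (inferInstance : (Subgroup.centralizer (M : Set G)).Normal).conj_mem x hx.2 g⟩)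
        fun g hg x hx => ?_) inf_le_left
      rwa [Subgroup.mem_centralizer_iff.1 hx.2 g hg, mul_inv_cancel_right]
    have : a ∈ A ⊓ Subgroup.centralizer M := by
      refine ⟨ha, Subgroup.mem_centralizer_iff.2 fun m hm => ?_⟩
      have := congrArg Subtype.val (DFunLike.congr_fun h1 (⟨m, hm⟩ : M))
      rw [MulAut.conjNormal_apply] at this
      exact (mul_inv_eq_iff_eq_mul.1 this).symm
    rwa [hZ, Subgroup.mem_bot] at this
  have : Fact (A.index).Prime := ⟨hA⟩
  have : IsCyclic M := isCyclic_of_prime_card hcard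
  apply hfaith a ha
  -- The automorphism group of `M`, of prime order `s`, is abelian of order `s - 1`. It kills
  -- commutators and elements of order coprime to `s - 1`.
  rcases h with h | h
  · have hle : ⁅A, A⁆ ≤ (MulAut.conjNormal (H := M)).ker := by
      rw [Subgroup.commutator_le]
      intro g _ k _
      rw [MonoidHom.mem_ker, map_commutatorElement, commutatorElement_eq_one_iff_mul_comm]
      exact mulAut_mul_comm _ _
    exact hle h
  · have h1 : orderOf (MulAut.conjNormal (H := M) a) ∣ A.index - 1 := by
      have := orderOf_dvd_natCard (MulAut.conjNormal (H := M) a)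
      rwa [IsCyclic.card_mulAut, hcard, Nat.totient_prime hA] at this
    rw [← orderOf_eq_one_iff]
    exact Nat.eq_one_of_dvd_coprimes h (orderOf_map_dvd _ a) h1

theorem mem_normalCore_of_prime_index [Group.IsSolvable G] {A : Subgroup G} (hA : A.index.Prime)
    {a : G} (ha : a ∈ A) (h : a ∈ ⁅A, A⁆ ∨ (orderOf a).Coprime (A.index - 1)) :
    a ∈ A.normalCore := by
  let f := QuotientGroup.mk' A.normalCore
  have hf : Function.Surjective f := QuotientGroup.mk'_surjective _
  have hker : f.ker ≤ A := by
    rw [QuotientGroup.ker_mk']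
    exact Subgroup.normalCore_le A
  have hindex : (A.map f).index = A.index := Subgroup.index_map_eq A hf hker
  refine (QuotientGroup.eq_one_iff a).1 (eq_one_of_coreFree (A := A.map f) (a := f a)
    (hindex ▸ hA) ?_ ⟨a, ha, rfl⟩ ?_)
  · intro N hN hNA
    have hcomap : N.comap f ≤ A.normalCore := by
      rw [Subgroup.normal_le_normalCore]
      intro x hx
      obtain ⟨y, hy, e⟩ := hNA hx
      have : y⁻¹ * x ∈ A := hker (by rw [MonoidHom.mem_ker, map_mul, map_inv, e, inv_mul_cancel])
      simpa using A.mul_mem hy this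
    rw [← Subgroup.map_comap_eq_self_of_surjective hf N, eq_bot_iff]
    rintro _ ⟨x, hx, rfl⟩
    exact (QuotientGroup.eq_one_iff x).2 (hcomap hx)
  · rw [hindex]
    refine h.imp (fun h => ?_) fun h => Nat.Coprime.coprime_dvd_left (orderOf_map_dvd f a) h
    rw [← Subgroup.map_commutator]
    exact ⟨a, h, rfl⟩

theorem orderOf_coprime_of_mem_coreIn {r n : ℕ} (hr : r.Prime) (hn : ¬ r ∣ n) {L : Subgroup G}
    {x : G} (hx : x ∈ coreIn r L) : (orderOf x).Coprime n := by
  have := (isPGroup_coreIn hr L).orderOf_coprime ((Nat.Prime.coprime_iff_not_dvd hr).2 hn) ⟨x, hx⟩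
  rwa [Subgroup.orderOf_mk] at this

/-- By `mem_normalCore_of_prime_index`, `x` lies in the core of `A` in `L`; that core is normal in
`L`, so its `r`-core is contained in that of `L`. -/
theorem mem_coreIn_of_prime_relIndex {r : ℕ} (hr : r.Prime) {A L : Subgroup G} (hAL : A ≤ L)
    (hL : Group.IsSolvable L) (hprime : (A.relIndex L).Prime) {x : G} (hx : x ∈ coreIn r A)
    (h : x ∈ ⁅A, A⁆ ∨ ¬ r ∣ A.relIndex L - 1) : x ∈ coreIn r L := by
  have hxA := coreIn_le r A hx
  have hcore : (⟨x, hAL hxA⟩ : L) ∈ (A.subgroupOf L).normalCore := by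
    refine mem_normalCore_of_prime_index hprime hxA (h.imp (fun h => ?_) fun h => ?_)
    · have hmap : A = (A.subgroupOf L).map L.subtype := by
        rw [Subgroup.subgroupOf_map_subtype, inf_eq_left.2 hAL]
      rw [hmap, ← Subgroup.map_commutator] at h
      obtain ⟨y, hy, e⟩ := h
      exact (Subtype.ext e : y = ⟨x, hAL hxA⟩) ▸ hy
    · rw [Subgroup.orderOf_mk]
      exact orderOf_coprime_of_mem_coreIn hr h hx
  let K : Subgroup G := (A.subgroupOf L).normalCore.map L.subtype
  have hKA : K ≤ A := by
    rintro _ ⟨y, hy, rfl⟩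
    exact Subgroup.normalCore_le (A.subgroupOf L) hy
  refine coreIn_le_coreIn hr (hKA.trans hAL) ?_ (mem_coreIn_of_le hr hKA hx ⟨_, hcore, rfl⟩)
  rintro g hg _ ⟨y, hy, rfl⟩
  exact ⟨_, (inferInstance : ((A.subgroupOf L).normalCore).Normal).conj_mem y hy ⟨g, hg⟩, rfl⟩

/-- Mutual permutability makes `A⟨c⟩` a product for every `c ∈ ⟨b⟩`. For a prime `s` dividing the
order of `b`, the index of `A⟨b ^ s⟩` in `A⟨b⟩` is 1 or `s`, so induction on the order of `b` climbs
from `A` to `A⟨b⟩`. -/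
theorem mem_coreIn_sup_zpowers {r : ℕ} (hr : r.Prime) {A B : Subgroup G}
    (hAB : MutuallyPermutable A B) (hA : Group.IsSolvable A) (hB : Group.IsSolvable B) {x : G}
    (hx : x ∈ coreIn r A)
    (h : x ∈ ⁅A, A⁆ ∨ ∀ s : ℕ, s.Prime → s ∣ Nat.card B → ¬ r ∣ s - 1) {b : G} (hb : b ∈ B) :
    x ∈ coreIn r (A ⊔ Subgroup.zpowers b) := by
  induction hn : orderOf b using Nat.strong_induction_on generalizing b with
  | _ n ih =>
    by_cases hb1 : b = 1
    · simpa [hb1] using hx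
    obtain ⟨s, hs, k, hk⟩ := Nat.exists_prime_and_dvd (orderOf_eq_one_iff.not.2 hb1)
    have hbs : b ^ s ∈ B := B.pow_mem hb s
    have horder : orderOf (b ^ s) = k := by
      rw [orderOf_pow_of_dvd hs.ne_zero ⟨k, hk⟩, hk, Nat.mul_div_cancel_left _ hs.pos]
    have hkpos : 0 < k := horder ▸ orderOf_pos _
    have hlt : orderOf (b ^ s) < n := by
      rw [← hn, horder, hk]
      exact lt_mul_left hkpos hs.one_lt
    have hx0 := ih _ hlt hbs rfl
    have hzle : Subgroup.zpowers (b ^ s) ≤ Subgroup.zpowers b :=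
      Subgroup.zpowers_le.2 (Subgroup.pow_mem _ (Subgroup.mem_zpowers b) s)
    have hle : A ⊔ Subgroup.zpowers (b ^ s) ≤ A ⊔ Subgroup.zpowers b := sup_le_sup_left hzle A
    have hrel : (A ⊔ Subgroup.zpowers (b ^ s)).relIndex (A ⊔ Subgroup.zpowers b) ∣ s := by
      have h1 : (Subgroup.zpowers (b ^ s)).relIndex (Subgroup.zpowers b) = s := by
        have := Subgroup.relIndex_mul_relIndex ⊥ _ _ bot_le hzle
        rw [Subgroup.relIndex_bot_left, Subgroup.relIndex_bot_left, Nat.card_zpowers,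
          Nat.card_zpowers, horder, hk, mul_comm] at this
        exact Nat.eq_of_mul_eq_mul_right hkpos this
      have h2 : Permutes (A ⊔ Subgroup.zpowers (b ^ s)) (Subgroup.zpowers b) :=
        (hAB.1 _ (Subgroup.zpowers_le.2 hb)).sup_left (Permutes.of_le hzle)
      have h3 : A ⊔ Subgroup.zpowers b = (A ⊔ Subgroup.zpowers (b ^ s)) ⊔ Subgroup.zpowers b := by
        rw [sup_assoc, sup_eq_right.2 hzle]
      conv_rhs => rw [← h1]
      rw [h3, h2.relIndex_sup]
      exact Subgroup.relIndex_dvd_of_le_left _ le_sup_right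
    rcases (Nat.dvd_prime hs).1 hrel with h1 | h1
    · rwa [← le_antisymm hle (Subgroup.relIndex_eq_one.1 h1)]
    · have := hAB.isSolvable_sup hA hB
      refine mem_coreIn_of_prime_relIndex hr hle
        (isSolvable_of_le (sup_le_sup_left (Subgroup.zpowers_le.2 hb) A)) (by rwa [h1]) hx0
        (h.imp (fun h => Subgroup.commutator_mono le_sup_left le_sup_left h) fun h => ?_)
      rw [h1]
      refine h s hs ((Dvd.intro k hk.symm).trans ?_)
      rw [← Nat.card_zpowers]
      exact Subgroup.card_dvd_of_le (Subgroup.zpowers_le.2 hb)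

/-- For `g = ba`, both `x` and `axa⁻¹` lie in `O_r(A⟨b⟩)`, hence so does `gxg⁻¹`, and the
Baer–Suzuki criterion applies. -/
theorem MutuallyPermutable.mem_coreIn_sup {r : ℕ} (hr : r.Prime) {A B : Subgroup G}
    (hAB : MutuallyPermutable A B) (hA : Group.IsSolvable A) (hB : Group.IsSolvable B) {x : G}
    (hx : x ∈ coreIn r A)
    (h : x ∈ ⁅A, A⁆ ∨ ∀ s : ℕ, s.Prime → s ∣ Nat.card B → ¬ r ∣ s - 1) :
    x ∈ coreIn r (A ⊔ B) := by
  refine mem_coreIn_of_forall_conj hr (Subgroup.mem_sup_left (coreIn_le r A hx)) fun g hg => ?_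
  obtain ⟨b, hb, a, ha, rfl⟩ := hAB.permutes.symm.mem_sup.1 (by rwa [sup_comm])
  refine ⟨coreIn r (A ⊔ Subgroup.zpowers b), isPGroup_coreIn hr _,
    mem_coreIn_sup_zpowers hr hAB hA hB hx h hb, ?_⟩
  have hxa : a * x * a⁻¹ ∈ coreIn r (A ⊔ Subgroup.zpowers b) := by
    refine mem_coreIn_sup_zpowers hr hAB hA hB (conj_mem_coreIn ha hx) (h.imp_left fun h => ?_) hb
    have := mul_mem (Subgroup.commutator_mem_commutator ha (coreIn_le r A hx)) h
    simpa [commutatorElement_def] using this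
  have := conj_mem_coreIn (Subgroup.mem_sup_right (Subgroup.mem_zpowers b)) hxa
  simpa [mul_assoc] using this

end PrimeIndex

/-! ### Products of several factors: elements of `O_r` and solubility -/

/-- The group is generated by a family of pairwise mutually permutable subgroups. -/
structure MutPermProduct {G ι : Type*} [Group G] [Fintype ι] (H : ι → Subgroup G) : Prop where
  mutPerm : ∀ i j, i ≠ j → MutuallyPermutable (H i) (H j)
  sup_eq_top : Finset.univ.sup H = ⊤

theorem groupPrimes_finset_sup {G ι : Type*} [Group G] {H : ι → Subgroup G}
    (hH : ∀ i j, Permutes (H i) (H j)) (s : Finset ι) :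
    groupPrimes (s.sup H : Subgroup G) ⊆ ⋃ i, groupPrimes (H i) := by
  classical
  induction s using Finset.induction_on with
  | empty =>
    intro p hp
    have h := hp.2
    rw [Finset.sup_empty, Subgroup.card_bot] at h
    exact absurd (Nat.dvd_one.1 h) hp.1.ne_one
  | insert i s hi ih =>
    rw [Finset.sup_insert]
    refine (Permutes.finset_sup_right fun j _ => hH i j).groupPrimes_sup_subset.trans
      (Set.union_subset (Set.subset_iUnion (fun i => groupPrimes (H i)) i) ih)

theorem groupPrimes_top (G : Type*) [Group G] : groupPrimes (⊤ : Subgroup G) = groupPrimes G := by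
  rw [groupPrimes, groupPrimes, Subgroup.card_top]

theorem card_quotient_lt {G : Type*} [Group G] [Finite G] {N : Subgroup G} (hN : N ≠ ⊥) :
    Nat.card (G ⧸ N) < Nat.card G := by
  rw [← Subgroup.card_mul_index N, Subgroup.index_eq_card]
  exact lt_mul_left Nat.card_pos ((Subgroup.one_lt_card_iff_ne_bot _).2 hN)

namespace MutPermProduct

variable {G ι : Type*} [Group G] [Fintype ι] {H : ι → Subgroup G}

theorem permutes (h : MutPermProduct H) (i j : ι) : Permutes (H i) (H j) := by
  by_cases hij : i = j
  · exact hij ▸ Permutes.refl _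
  · exact (h.mutPerm i j hij).permutes

theorem map {G' : Type*} [Group G'] (h : MutPermProduct H) {f : G →* G'}
    (hf : Function.Surjective f) : MutPermProduct fun i => (H i).map f where
  mutPerm i j hij := (h.mutPerm i j hij).map f
  sup_eq_top := by
    have : (Finset.univ.sup H).map f = Finset.univ.sup fun i => (H i).map f := by
      simp only [Finset.sup_univ_eq_iSup, Subgroup.map_iSup]
    rw [← this, h.sup_eq_top, Subgroup.map_top_of_surjective f hf]

theorem groupPrimes_subset (h : MutPermProduct H) : groupPrimes G ⊆ ⋃ i, groupPrimes (H i) := by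
  rw [← groupPrimes_top, ← h.sup_eq_top]
  exact groupPrimes_finset_sup h.permutes _

theorem mem_oPi [Finite G] (h : MutPermProduct H) (hsol : ∀ i, Group.IsSolvable (H i)) {r : ℕ}
    (hr : r.Prime) {i : ι} {x : G} (hx : x ∈ coreIn r (H i))
    (hx' : x ∈ ⁅H i, H i⁆ ∨ ∀ s : ℕ, s.Prime → s ∣ Nat.card G → ¬ r ∣ s - 1) :
    x ∈ oPi {r} G := by
  have := mem_coreIn_finset_sup hr h.permutes i hx (fun j => ?_) Finset.univ
  · rw [h.sup_eq_top, sup_top_eq] at this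
    exact coreIn_top_le_oPi hr this
  · by_cases hij : i = j
    · rwa [← hij, sup_idem]
    · exact (h.mutPerm i j hij).mem_coreIn_sup hr (hsol i) (hsol j) hx (hx'.imp_right
        fun hs s hsp hsd => hs s hsp (hsd.trans (H j).card_subgroup_dvd_card))

/-- Some factor of a nontrivial pairwise mutually permutable product of soluble groups meets some
`O_r(G)` nontrivially. -/
theorem exists_mem_oPi [Finite G] [Nontrivial G] (h : MutPermProduct H)
    (hsol : ∀ i, Group.IsSolvable (H i)) :
    ∃ i, ∃ r : ℕ, r.Prime ∧ ∃ x ∈ H i, x ∈ oPi {r} G ∧ x ≠ 1 := by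
  -- A nonabelian factor supplies an element of its derived subgroup, for which no arithmetic
  -- condition is needed.
  by_cases hab : ∃ i, commutator (H i) ≠ ⊥
  · obtain ⟨i, hi⟩ := hab
    have := hsol i
    obtain ⟨r, hr, x, hx, hxr, hx1⟩ := exists_mem_oPi_of_normal hi
    refine ⟨i, r, hr, x, x.2, h.mem_oPi hsol hr ⟨x, hxr, rfl⟩ (Or.inl ?_), ?_⟩
    · have hmap := Subgroup.map_commutator ⊤ ⊤ (H i).subtype
      rw [← MonoidHom.range_eq_map, Subgroup.range_subtype] at hmap
      rw [← hmap]
      exact ⟨x, hx, rfl⟩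
    · exact fun h1 => hx1 (Subtype.ext h1)
  · push Not at hab
    -- All factors are abelian. The largest prime divisor `r` of `|G|` cannot divide `s - 1` for a
    -- prime divisor `s ≤ r`.
    have hne : (Nat.card G).primeFactors.Nonempty :=
      Nat.nonempty_primeFactors.2 Finite.one_lt_card
    obtain ⟨r, hrG, hmax⟩ := Finset.exists_max_image _ id hne
    have hr := Nat.prime_of_mem_primeFactors hrG
    obtain ⟨i, hi⟩ := Set.mem_iUnion.1 (h.groupPrimes_subset
      ⟨hr, Nat.dvd_of_mem_primeFactors hrG⟩)
    have : Fact r.Prime := ⟨hr⟩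
    obtain ⟨x, hx⟩ := exists_prime_orderOf_dvd_card' r hi.2
    have hcomm : ∀ g : H i, g * x * g⁻¹ = x := fun g => by
      have := Subgroup.commutator_mem_commutator (Subgroup.mem_top g) (Subgroup.mem_top x)
      rw [← commutator_def, hab i, Subgroup.mem_bot, commutatorElement_eq_one_iff_mul_comm] at this
      rw [this, mul_inv_cancel_right]
    refine ⟨i, r, hr, x, x.2, h.mem_oPi hsol hr (i := i) ?_ (Or.inr ?_), ?_⟩
    · have : (Subgroup.zpowers x).Normal := ⟨by
        rintro _ ⟨k, rfl⟩ g
        refine ⟨k, ?_⟩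
        change x ^ k = g * x ^ k * g⁻¹
        rw [← conj_zpow, hcomm]⟩
      have hP : IsPGroup r (Subgroup.zpowers x) :=
        IsPGroup.of_card (n := 1) (by rw [Nat.card_zpowers, hx, pow_one])
      exact ⟨x, hP.le_oPi hr (Subgroup.mem_zpowers x), rfl⟩
    · intro s hs hsG hdvd
      have h1 : s ≤ r := hmax s (Nat.mem_primeFactors.2 ⟨hs, hsG, Nat.card_pos.ne'⟩)
      have h2 := hs.two_le
      have := Nat.le_of_dvd (by omega) hdvd
      omega
    · intro h1
      rw [(Subtype.ext h1 : x = 1), orderOf_one] at hx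
      exact hr.one_lt.ne hx

theorem isSolvable [Finite G] (h : MutPermProduct H) (hsol : ∀ i, Group.IsSolvable (H i)) :
    Group.IsSolvable G := by
  suffices ∀ n : ℕ, ∀ (G : Type _) [Group G] [Finite G] (H : ι → Subgroup G), Nat.card G = n →
      MutPermProduct H → (∀ i, Group.IsSolvable (H i)) → Group.IsSolvable G from
    this _ G H rfl h hsol
  intro n
  induction n using Nat.strong_induction_on with
  | _ n ih =>
    intro G _ _ H hn h hsol
    rcases subsingleton_or_nontrivial G with hG | hG
    · infer_instance
    obtain ⟨i, r, hr, x, -, hx, hx1⟩ := h.exists_mem_oPi hsol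
    have hne : oPi {r} G ≠ ⊥ := fun hbot => hx1 (by rwa [hbot, Subgroup.mem_bot] at hx)
    have : Fact r.Prime := ⟨hr⟩
    have := (isPGroup_oPi (G := G) hr).isNilpotent
    rw [Group.isSolvable_iff_subgroup_quotient (oPi {r} G)]
    exact ⟨inferInstance, ih _ (hn ▸ card_quotient_lt hne) _ _ rfl
      (h.map (QuotientGroup.mk'_surjective _)) fun i => isSolvable_map _ _⟩

end MutPermProduct

/-! ### Action of `q`-elements on `p`-subgroups: subgroups, images, extensions -/

/-- Every `q`-element of `G` that normalizes a `p`-subgroup centralizes it. -/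
def ActsTrivially (p q : ℕ) (G : Type*) [Group G] : Prop :=
  ∀ (P : Subgroup G) (x : G), IsPGroup p P → (∃ k, x ^ q ^ k = 1) →
    (∀ u ∈ P, x * u * x⁻¹ ∈ P) → ∀ u ∈ P, x * u = u * x

section

variable {G : Type*} [Group G]

theorem conj_pow_eq_mul_pow {x u z : G} (h : x * u * x⁻¹ = u * z) (hz : x * z = z * x) (n : ℕ) :
    x ^ n * u * (x ^ n)⁻¹ = u * z ^ n := by
  induction n with
  | zero => simp
  | succ n ih =>
    have hz' : x * z ^ n * x⁻¹ = z ^ n := by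
      rw [(Commute.pow_right (hz : Commute x z) n).eq, mul_inv_cancel_right]
    calc x ^ (n + 1) * u * (x ^ (n + 1))⁻¹ = x * (x ^ n * u * (x ^ n)⁻¹) * x⁻¹ := by
          rw [pow_succ']; group
      _ = (x * u * x⁻¹) * (x * z ^ n * x⁻¹) := by rw [ih]; group
      _ = u * z ^ (n + 1) := by rw [h, hz', pow_succ', mul_assoc]

theorem eq_one_of_pow_eq_one_of_pow_eq_one {p q k m : ℕ} (hp : p.Prime) (hq : q.Prime)
    (hpq : p ≠ q) {z : G} (h1 : z ^ p ^ k = 1) (h2 : z ^ q ^ m = 1) : z = 1 := by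
  rw [← orderOf_eq_one_iff]
  exact Nat.eq_one_of_dvd_coprimes (Nat.Coprime.pow k m ((Nat.coprime_primes hp hq).2 hpq))
    (orderOf_dvd_of_pow_eq_one h1) (orderOf_dvd_of_pow_eq_one h2)

theorem IsPGroup.exists_pow_eq_one {p : ℕ} {P : Subgroup G} (hP : IsPGroup p P) {u : G}
    (hu : u ∈ P) : ∃ k, u ^ p ^ k = 1 := by
  obtain ⟨k, hk⟩ := isPGroup_iff_pow_pow_eq_one.1 hP ⟨u, hu⟩
  exact ⟨k, congrArg Subtype.val hk⟩

/-- Iterating the conjugation `q ^ k` times gives `u = u * z ^ q ^ k`, so the order of `z` is a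
power of both `p` and `q`. -/
theorem commute_of_conj_eq_mul {p q k m : ℕ} (hp : p.Prime) (hq : q.Prime) (hpq : p ≠ q)
    {x u z : G} (h : x * u * x⁻¹ = u * z) (hz : x * z = z * x) (hx : x ^ q ^ k = 1)
    (hz' : z ^ p ^ m = 1) : x * u = u * x := by
  have h1 := conj_pow_eq_mul_pow h hz (q ^ k)
  rw [hx, one_mul, inv_one, mul_one, left_eq_mul] at h1
  rw [eq_one_of_pow_eq_one_of_pow_eq_one hp hq hpq hz' h1, mul_one] at h
  exact mul_inv_eq_iff_eq_mul.1 h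

/-- A `q`-element of a homomorphic image lifts to a `q`-element among the powers of any lift. -/
theorem exists_pow_map_eq [Finite G] {G' : Type*} [Group G'] (f : G →* G') {q k : ℕ}
    (hq : q.Prime) {g : G} (hg : f g ^ q ^ k = 1) :
    ∃ n, f (g ^ n) = f g ∧ ∃ m, (g ^ n) ^ q ^ m = 1 := by
  obtain ⟨m, d, hd, hmd⟩ := Nat.exists_eq_pow_mul_and_not_dvd (orderOf_pos g).ne' q hq.ne_one
  have hcop : d.Coprime (q ^ k) :=
    (Nat.Coprime.pow_left k ((Nat.Prime.coprime_iff_not_dvd hq).2 hd)).symm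
  -- The exponent kills the `q'`-part of `g` and is 1 modulo the order of `f g`.
  obtain ⟨n, hn0, hn1⟩ := Nat.chineseRemainder hcop 0 1
  refine ⟨n, ?_, m, ?_⟩
  · rw [map_pow]
    conv_rhs => rw [← pow_one (f g)]
    exact pow_eq_pow_iff_modEq.2 (hn1.of_dvd (orderOf_dvd_of_pow_eq_one hg))
  · rw [← pow_mul, ← orderOf_dvd_iff_pow_eq_one, hmd, mul_comm]
    exact Nat.mul_dvd_mul ((Nat.modEq_zero_iff_dvd).1 hn0) dvd_rfl

namespace ActsTrivially

variable {p q : ℕ}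

theorem of_injective {G' : Type*} [Group G'] {f : G' →* G} (hf : Function.Injective f)
    (h : ActsTrivially p q G) : ActsTrivially p q G' := by
  rintro P x hP ⟨k, hk⟩ hn u hu
  apply hf
  rw [map_mul, map_mul]
  refine h (P.map f) (f x) (hP.map f) ⟨k, by rw [← map_pow, hk, map_one]⟩ ?_ _ ⟨u, hu, rfl⟩
  rintro _ ⟨v, hv, rfl⟩
  exact ⟨_, hn v hv, by simp⟩

theorem subgroup (h : ActsTrivially p q G) (H : Subgroup G) : ActsTrivially p q H :=
  h.of_injective H.subtype_injective

theorem commute_of_mem {H : Subgroup G} (h : ActsTrivially p q H) {P : Subgroup G} (hPH : P ≤ H)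
    (hP : IsPGroup p P) {x : G} (hxH : x ∈ H) (hx : ∃ k, x ^ q ^ k = 1)
    (hn : ∀ u ∈ P, x * u * x⁻¹ ∈ P) {u : G} (hu : u ∈ P) : x * u = u * x := by
  obtain ⟨k, hk⟩ := hx
  exact congrArg Subtype.val (h (P.subgroupOf H) ⟨x, hxH⟩ hP.comap_subtype
    ⟨k, Subtype.ext hk⟩ (fun u hu => hn u hu) ⟨u, hPH hu⟩ hu)

/-- The configuration in `G'` is lifted by the Frattini argument: a Sylow `p`-subgroup of the
preimage of `P'` still maps onto `P'`, and the acting element has a lift normalizing it, of which a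
suitable power is a `q`-element. -/
theorem of_surjective [Finite G] {G' : Type*} [Group G'] {f : G →* G'}
    (hf : Function.Surjective f) (hp : p.Prime) (hq : q.Prime) (h : ActsTrivially p q G) :
    ActsTrivially p q G' := by
  have : Fact p.Prime := ⟨hp⟩
  have : Finite G' := Finite.of_surjective f hf
  rintro P' x' hP' ⟨k, hk⟩ hn u' hu'
  -- the action takes place in the preimage `T` of the normalizer of `P'`, where the preimage `L`
  -- of `P'` is normal
  let T : Subgroup G := (Subgroup.normalizer (P' : Set G')).comap f
  let L : Subgroup T := (P'.comap f).subgroupOf T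
  have hPT : P'.comap f ≤ T := Subgroup.comap_mono Subgroup.le_normalizer
  have hL : L.Normal := ⟨fun l hl t => by
    have := (Subgroup.mem_normalizer_iff.1 t.2 (f l)).1 hl
    change f (t * l * (t : G)⁻¹) ∈ P'
    rwa [map_mul, map_mul, map_inv]⟩
  let φ : L →* P' := ((f.comp T.subtype).comp L.subtype).codRestrict P' fun l => l.2
  have hφ : Function.Surjective φ := by
    rintro ⟨v, hv⟩
    obtain ⟨g, rfl⟩ := hf v
    exact ⟨⟨⟨g, hPT hv⟩, hv⟩, rfl⟩
  obtain ⟨P⟩ : Nonempty (Sylow p L) := inferInstance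
  have hPtop : (P : Subgroup L).map φ = ⊤ := by
    rw [← Sylow.coe_mapSurjective hφ]
    exact ((P.mapSurjective hφ).3 (hP'.to_subgroup ⊤) le_top).symm
  obtain ⟨x, rfl⟩ := hf x'
  have hxT : x ∈ T := mem_normalizer_of_forall_conj_mem hn
  have hfr := P.normalizer_sup_eq_top
  obtain ⟨l, hl, n, hnm, e⟩ := (Permutes.of_normal L _).mem_sup.1
    (show (⟨x, hxT⟩ : T) ∈ L ⊔ _ by rw [sup_comm, hfr]; trivial)
  -- replace `l` by an element of `P`
  obtain ⟨v, hv, hvl⟩ : (φ ⟨l, hl⟩) ∈ (P : Subgroup L).map φ := by rw [hPtop]; trivial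
  have hvl' : f (v : T) = f (l : G) := congrArg Subtype.val hvl
  let Q : Subgroup T := (P : Subgroup L).map L.subtype
  have hvQ : (v : T) ∈ Q := ⟨v, hv, rfl⟩
  have hfy : f ((v : T) * n : T) = f x := by
    have e' : (l : G) * n = x := congrArg Subtype.val e
    rw [← e', map_mul, Subgroup.coe_mul, map_mul, hvl']
  have hyN : (v : T) * n ∈ Subgroup.normalizer (Q : Set T) :=
    mul_mem (Subgroup.le_normalizer hvQ) hnm
  obtain ⟨N, hN, m, hm⟩ := exists_pow_map_eq (f.comp T.subtype) hq (g := (v : T) * n) (k := k)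
    (by rw [MonoidHom.comp_apply]; exact hfy ▸ hk)
  have hN' : f (((v : T) * n) ^ N : T) = f x := hN.trans hfy
  obtain ⟨w, hw, hwu⟩ : (⟨u', hu'⟩ : P') ∈ (P : Subgroup L).map φ := by rw [hPtop]; trivial
  have hwu' : f (w : T) = u' := congrArg Subtype.val hwu
  have hyN' := pow_mem hyN N
  have := h.subgroup T Q _ (P.2.map _) ⟨m, hm⟩
    (fun u hu => (Subgroup.mem_normalizer_iff.1 hyN' u).1 hu) w ⟨w, hw, rfl⟩
  have := congrArg (fun t : T => f t) this
  simp only [Subgroup.coe_mul, map_mul] at this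
  rwa [hN', hwu'] at this

theorem map [Finite G] {G' : Type*} [Group G'] (f : G →* G') (hp : p.Prime) (hq : q.Prime)
    {H : Subgroup G} (h : ActsTrivially p q H) : ActsTrivially p q (H.map f) :=
  h.of_surjective (f.subgroupMap_surjective H) hp hq

/-- By hypothesis on the quotient, `z = u⁻¹(xux⁻¹)` lies in `R ⊓ P`, so `x` commutes with it and
`commute_of_conj_eq_mul` applies. -/
theorem of_quotient [Finite G] (hp : p.Prime) (hq : q.Prime) (hpq : p ≠ q) {R : Subgroup G}
    [R.Normal] (hR : ∀ x : G, (∃ k, x ^ q ^ k = 1) → ∀ z ∈ R, (∃ m, z ^ p ^ m = 1) → x * z = z * x)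
    (h : ActsTrivially p q (G ⧸ R)) : ActsTrivially p q G := by
  rintro P x hP ⟨k, hk⟩ hn u hu
  let f := QuotientGroup.mk' R
  have hcomm : f x * f u = f u * f x := by
    refine h (P.map f) (f x) (hP.map f) ⟨k, by rw [← map_pow, hk, map_one]⟩ ?_ _ ⟨u, hu, rfl⟩
    rintro _ ⟨v, hv, rfl⟩
    exact ⟨_, hn v hv, by simp⟩
  have hzR : u⁻¹ * (x * u * x⁻¹) ∈ R := by
    apply (QuotientGroup.eq_one_iff _).1
    change f (u⁻¹ * (x * u * x⁻¹)) = 1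
    simp only [map_mul, map_inv, hcomm]
    group
  obtain ⟨m, hm⟩ := hP.exists_pow_eq_one (P.mul_mem (P.inv_mem hu) (hn u hu))
  exact commute_of_conj_eq_mul hp hq hpq (z := u⁻¹ * (x * u * x⁻¹)) (by group)
    (hR x ⟨k, hk⟩ _ hzR ⟨m, hm⟩) hk hm

theorem of_quotient_of_coprime [Finite G] (hp : p.Prime) (hq : q.Prime) (hpq : p ≠ q)
    {N : Subgroup G} [N.Normal] (hN : ¬ p ∣ Nat.card N) (h : ActsTrivially p q (G ⧸ N)) :
    ActsTrivially p q G := by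
  refine h.of_quotient hp hq hpq fun x _ z hz ⟨m, hm⟩ => ?_
  have hz1 : z = 1 := by
    rw [← orderOf_eq_one_iff]
    refine Nat.eq_one_of_dvd_coprimes (Nat.Coprime.pow_left m
      ((Nat.Prime.coprime_iff_not_dvd hp).2 hN)) (orderOf_dvd_of_pow_eq_one hm) ?_
    rw [← Nat.card_zpowers]
    exact Subgroup.card_dvd_of_le (Subgroup.zpowers_le.2 hz)
  rw [hz1, mul_one, one_mul]

end ActsTrivially

end

/-! ### Action of `q`-elements of one factor on the `p`-part of another -/

section

variable {G : Type*} [Group G] {p q : ℕ}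

/-- If a `q`-element normalizes the `p`-group `Y` and `q ∤ p - 1`, then its centralizer in `Y`
does not have index `p`. -/
theorem le_centralizer_of_relIndex_dvd [Finite G] (hp : p.Prime) (hq : q.Prime) (hpq : p ≠ q)
    (hnd : ¬ q ∣ p - 1) {Y : Subgroup G} (hY : IsPGroup p Y) {x : G} {k : ℕ}
    (hx : x ^ q ^ k = 1) (hn : ∀ u ∈ Y, x * u * x⁻¹ ∈ Y)
    (hindex : (Y ⊓ Subgroup.centralizer {x}).relIndex Y ∣ p) : Y ≤ Subgroup.centralizer {x} := by
  classical
  have : Fact p.Prime := ⟨hp⟩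
  have : Fact q.Prime := ⟨hq⟩
  set C := Y ⊓ Subgroup.centralizer {x} with hC
  rcases (Nat.dvd_prime hp).1 hindex with h1 | h1
  · exact (Subgroup.relIndex_eq_one.1 h1).trans inf_le_right
  exfalso
  let f : Function.End Y := fun u => ⟨x * u * x⁻¹, hn u u.2⟩
  have hf : ∀ n : ℕ, ∀ u : Y, ((f ^ n) u : G) = x ^ n * u * (x ^ n)⁻¹ := by
    intro n
    induction n with
    | zero => intro u; change (u : G) = _; simp
    | succ n ih =>
      intro u
      rw [pow_succ]
      change ((f ^ n) (f u) : G) = _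
      rw [ih]
      change x ^ n * (x * u * x⁻¹) * (x ^ n)⁻¹ = _
      rw [pow_succ]
      group
  have hfk : f ^ q ^ k = 1 := by
    funext u
    apply Subtype.ext
    rw [hf, hx]
    change _ = (u : G)
    simp
  have := Fintype.ofFinite Y
  -- Counting fixed points of conjugation by `x` gives `|Y| ≡ |C|` modulo `q`. With `|Y| = p|C|` and
  -- `q ∤ |C|` this yields `q ∣ p - 1`.
  have hmod := Equiv.Perm.card_fixedPoints_modEq hfk
  have hfix : Fintype.card (Function.fixedPoints f) = Nat.card C := by
    rw [← Nat.card_eq_fintype_card]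
    refine Nat.card_congr
      { toFun := fun u => ⟨u.1, u.1.2, Subgroup.mem_centralizer_singleton_iff.2 ?_⟩
        invFun := fun c => ⟨⟨c, c.2.1⟩, Subtype.ext ?_⟩
        left_inv := fun _ => rfl
        right_inv := fun _ => rfl }
    · have : x * (u.1 : G) * x⁻¹ = u.1 := congrArg Subtype.val u.2
      exact (mul_inv_eq_iff_eq_mul.1 this).symm
    · have := Subgroup.mem_centralizer_singleton_iff.1 c.2.2
      exact mul_inv_eq_iff_eq_mul.2 this.symm
  have hcard : Nat.card Y = Nat.card C * p := by
    have := Subgroup.relIndex_mul_relIndex ⊥ C Y bot_le inf_le_left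
    rwa [Subgroup.relIndex_bot_left, Subgroup.relIndex_bot_left, h1, eq_comm] at this
  rw [hfix, ← Nat.card_eq_fintype_card, hcard] at hmod
  obtain ⟨m, hm⟩ := IsPGroup.iff_card.1 (hY.to_le (inf_le_left : C ≤ Y))
  have hcop : Nat.gcd q (Nat.card C) = 1 := by
    rw [hm]
    exact Nat.Coprime.pow_right m ((Nat.coprime_primes hq hp).2 hpq.symm)
  have hmod' : Nat.card C * p ≡ Nat.card C * 1 [MOD q] := by rwa [mul_one]
  have := Nat.ModEq.cancel_left_of_coprime hcop hmod'
  exact hnd ((Nat.modEq_iff_dvd' hp.one_lt.le).1 this.symm)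

variable {P A B : Subgroup G} [hPn : P.Normal]

/-- `B` permutes with `⟨y⟩`, and normality of `P` forces the remaining factor from `B` into `P`.
This is what makes the join of the intersections with `P` normal. -/
theorem conj_mem_zpowers_mul (hAB : MutuallyPermutable A B) {y : G} (hy : y ∈ P ⊓ A) {h : G}
    (hh : h ∈ B) : ∃ z ∈ Subgroup.zpowers y, ∃ c ∈ P ⊓ B, h * y * h⁻¹ = z * c := by
  obtain ⟨z, hz, h', hh', e⟩ := (hAB.2 _ (Subgroup.zpowers_le.2 hy.2)).exists_eq hh
    (Subgroup.mem_zpowers y)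
  refine ⟨z, hz, h' * h⁻¹, ⟨?_, B.mul_mem hh' (B.inv_mem hh)⟩, by rw [e, mul_assoc]⟩
  have : h' * h⁻¹ = z⁻¹ * (h * y * h⁻¹) := by rw [e]; group
  rw [this]
  exact P.mul_mem (P.inv_mem (Subgroup.zpowers_le.2 hy.1 hz)) (hPn.conj_mem y hy.1 h)

/-- By induction on the order of `y`, `x` centralizes `y ^ p`; it also centralizes `P ⊓ B`. Since `P
⊓ ⟨y⟩B = ⟨y⟩(P ⊓ B)`, the centralizer of `x` there has index at most `p`, and
`le_centralizer_of_relIndex_dvd` rules out index `p`. -/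
theorem commute_of_mutuallyPermutable [Finite G] (hp : p.Prime) (hq : q.Prime) (hpq : p ≠ q)
    (hP : IsPGroup p P) (hAB : MutuallyPermutable A B) (hB : ActsTrivially p q B)
    (hnd : ¬ q ∣ p - 1) {x : G} (hxB : x ∈ B) {k : ℕ} (hx : x ^ q ^ k = 1) {y : G}
    (hy : y ∈ P ⊓ A) : x * y = y * x := by
  classical
  have : Fact p.Prime := ⟨hp⟩
  have hPB : ∀ c ∈ P ⊓ B, x * c = c * x := fun c hc =>
    hB.commute_of_mem inf_le_right (hP.to_le inf_le_left) hxB ⟨k, hx⟩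
      (fun u hu => ⟨hPn.conj_mem u hu.1 x, B.mul_mem (B.mul_mem hxB hu.2) (B.inv_mem hxB)⟩) hc
  induction hn : orderOf y using Nat.strong_induction_on generalizing y with
  | _ n ih =>
    by_cases hy1 : y = 1
    · rw [hy1, mul_one, one_mul]
    obtain ⟨d, hd⟩ : p ∣ orderOf y := by
      have := hP.dvd_orderOf (g := ⟨y, hy.1⟩) fun h => hy1 (congrArg Subtype.val h)
      rwa [Subgroup.orderOf_mk] at this
    have hlt : orderOf (y ^ p) < n := by
      rw [orderOf_pow_of_dvd hp.ne_zero ⟨d, hd⟩, ← hn]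
      exact Nat.div_lt_self (orderOf_pos y) hp.one_lt
    have hyp : x * y ^ p = y ^ p * x := ih _ hlt ((P ⊓ A).pow_mem hy p) rfl
    let Y : Subgroup G := P ⊓ (Subgroup.zpowers y ⊔ B)
    have hperm : Permutes (Subgroup.zpowers y) B := (hAB.2 _ (Subgroup.zpowers_le.2 hy.2)).symm
    have hxY : ∀ u ∈ Y, x * u * x⁻¹ ∈ Y := fun u hu => ⟨hPn.conj_mem u hu.1 x,
      Subgroup.mul_mem _ (Subgroup.mul_mem _ (Subgroup.mem_sup_right hxB) hu.2)
        (Subgroup.inv_mem _ (Subgroup.mem_sup_right hxB))⟩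
    have hyY : y ∈ Y := ⟨hy.1, Subgroup.mem_sup_left (Subgroup.mem_zpowers y)⟩
    have hYp : IsPGroup p Y := hP.to_le inf_le_left
    set C := Y ⊓ Subgroup.centralizer {x} with hC
    have hindex : C.relIndex Y ∣ p := by
      obtain ⟨a, ha⟩ := hYp.index (C.subgroupOf Y)
      have hle : C.relIndex Y ≤ p := by
        rw [← Nat.card_fin p]
        refine Nat.card_le_card_of_surjective
          (fun i : Fin p => ((⟨y, hyY⟩ ^ (i : ℕ) : Y) : Y ⧸ C.subgroupOf Y)) fun u => ?_
        induction u using QuotientGroup.induction_on with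
        | _ u =>
        obtain ⟨u, hu⟩ := u
        obtain ⟨z, hz, c, hc, e⟩ := hperm.mem_sup.1 hu.2
        obtain ⟨m, rfl⟩ := (mem_zpowers_iff_mem_range_orderOf.1 hz |> Finset.mem_image.1).imp
          fun _ h => h.2
        -- Powers of `y ^ p` lie in `C`, so only the exponent modulo `p` matters for the coset.
        refine ⟨⟨m % p, Nat.mod_lt _ hp.pos⟩, QuotientGroup.eq.2 ?_⟩
        have hcP : c ∈ P := by
          have : c = (y ^ m)⁻¹ * u := by rw [← e]; group
          rw [this]
          exact P.mul_mem (P.inv_mem (P.pow_mem hy.1 m)) hu.1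
        have hval : (y ^ (m % p))⁻¹ * u = (y ^ p) ^ (m / p) * c := by
          rw [← e, inv_mul_eq_iff_eq_mul, ← mul_assoc, ← pow_mul, ← pow_add, Nat.mod_add_div]
        rw [Subgroup.mem_subgroupOf]
        change (y ^ (m % p))⁻¹ * u ∈ C
        refine ⟨Y.mul_mem (Y.inv_mem (Y.pow_mem hyY _)) hu, ?_⟩
        rw [hval]
        exact mul_mem (pow_mem (Subgroup.mem_centralizer_singleton_iff.2 hyp.symm) _)
          (Subgroup.mem_centralizer_singleton_iff.2 (hPB c ⟨hcP, hc⟩).symm)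
      have ha' : C.relIndex Y = p ^ a := ha
      rw [ha'] at hle ⊢
      have : a ≤ 1 := by
        rw [← Nat.pow_le_pow_iff_right hp.one_lt, pow_one]
        exact hle
      exact (Nat.pow_dvd_pow p this).trans (by rw [pow_one])
    exact (Subgroup.mem_centralizer_singleton_iff.1
      (le_centralizer_of_relIndex_dvd hp hq hpq hnd hYp hx hxY hindex hyY)).symm

end

/-! ### Passage of trivial action from the factors to the product -/

namespace MutPermProduct

variable {G ι : Type*} [Group G] [Finite G] [Fintype ι] {H : ι → Subgroup G} {p q : ℕ}

/-- The subgroup generated by the intersections of the factors with a normal subgroup is normal. -/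
theorem iSup_inf_normal (h : MutPermProduct H) (P : Subgroup G) [hP : P.Normal] :
    (⨆ i, P ⊓ H i).Normal := by
  rw [← Subgroup.normalizer_eq_top_iff, ← top_le_iff, ← h.sup_eq_top]
  refine Finset.sup_le fun j _ g hg => mem_normalizer_of_forall_conj_mem ?_
  have hle : ∀ i, P ⊓ H i ≤ ⨆ i, P ⊓ H i := le_iSup fun i => P ⊓ H i
  suffices (⨆ i, P ⊓ H i) ≤ (⨆ i, P ⊓ H i).comap (MulAut.conj g).toMonoidHom from this
  refine iSup_le fun i y hy => ?_
  change g * y * g⁻¹ ∈ ⨆ i, P ⊓ H i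
  by_cases hij : i = j
  · subst hij
    exact hle i ⟨hP.conj_mem y hy.1 g, (H i).mul_mem ((H i).mul_mem hg hy.2) ((H i).inv_mem hg)⟩
  · obtain ⟨z, hz, c, hc, e⟩ := conj_mem_zpowers_mul (h.mutPerm i j hij) hy hg
    rw [e]
    exact mul_mem (hle i (Subgroup.zpowers_le.2 hy hz)) (hle j hc)

/-- The quotient by the centralizer of `R` is the product of the images of the factors. None has
order divisible by `q`, since a `q`-element of an image lifts to a `q`-element of the factor, which
centralizes `R`. -/
theorem commute_of_forall_factor (h : MutPermProduct H) (hq : q.Prime) {R : Subgroup G}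
    [R.Normal] (hR : ∀ i, ∀ x ∈ H i, (∃ k, x ^ q ^ k = 1) → ∀ z ∈ R, x * z = z * x) {x : G}
    (hx : ∃ k, x ^ q ^ k = 1) {z : G} (hz : z ∈ R) : x * z = z * x := by
  have : Fact q.Prime := ⟨hq⟩
  let f := QuotientGroup.mk' (Subgroup.centralizer (R : Set G))
  have hmem : ∀ {x : G}, f x = 1 ↔ ∀ z ∈ R, x * z = z * x := by
    intro x
    rw [show f x = 1 ↔ x ∈ Subgroup.centralizer (R : Set G) from QuotientGroup.eq_one_iff x,
      Subgroup.mem_centralizer_iff]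
    exact ⟨fun h z hz => (h z hz).symm, fun h z hz => (h z hz).symm⟩
  have hnd : ¬ q ∣ Nat.card (G ⧸ Subgroup.centralizer (R : Set G)) := by
    intro hdvd
    obtain ⟨i, hi⟩ := Set.mem_iUnion.1
      ((h.map (f := f) (QuotientGroup.mk'_surjective _)).groupPrimes_subset ⟨hq, hdvd⟩)
    obtain ⟨y, hy⟩ := exists_prime_orderOf_dvd_card' q hi.2
    obtain ⟨g, hg, e⟩ := y.2
    rw [← Subgroup.orderOf_coe, ← e] at hy
    obtain ⟨n, hn, hm⟩ := exists_pow_map_eq f hq (g := g) (k := 1)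
      (by rw [pow_one, ← hy, pow_orderOf_eq_one])
    have h1 : f g = 1 := hn ▸ hmem.2 (hR i _ ((H i).pow_mem hg n) hm)
    rw [h1, orderOf_one] at hy
    exact hq.one_lt.ne hy
  obtain ⟨k, hk⟩ := hx
  refine hmem.1 ?_ z hz
  rw [← orderOf_eq_one_iff]
  exact Nat.eq_one_of_dvd_coprimes (Nat.Coprime.pow_left k
    ((Nat.Prime.coprime_iff_not_dvd hq).2 hnd))
    (orderOf_dvd_of_pow_eq_one (by rw [← map_pow, hk, map_one])) (orderOf_dvd_natCard _)

theorem actsTrivially (hp : p.Prime) (hq : q.Prime) (hpq : p ≠ q) (h : MutPermProduct H)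
    (hsol : ∀ i, Group.IsSolvable (H i)) (hact : ∀ i, ActsTrivially p q (H i))
    (hprimes : ∀ i j, i ≠ j → p ∈ groupPrimes (H i) → q ∈ groupPrimes (H j) → ¬ q ∣ p - 1) :
    ActsTrivially p q G := by
  suffices ∀ n : ℕ, ∀ (G : Type _) [Group G] [Finite G] (H : ι → Subgroup G), Nat.card G = n →
      MutPermProduct H → (∀ i, Group.IsSolvable (H i)) → (∀ i, ActsTrivially p q (H i)) →
      (∀ i j, i ≠ j → p ∈ groupPrimes (H i) → q ∈ groupPrimes (H j) → ¬ q ∣ p - 1) →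
      ActsTrivially p q G from
    this _ G H rfl h hsol hact hprimes
  have : Fact p.Prime := ⟨hp⟩
  have : Fact q.Prime := ⟨hq⟩
  intro n
  induction n using Nat.strong_induction_on with
  | _ n ih =>
    intro G _ _ H hn h hsol hact hprimes
    have quot : ∀ N : Subgroup G, ∀ _ : N.Normal, N ≠ ⊥ → ActsTrivially p q (G ⧸ N) := by
      intro N _ hN
      refine ih _ (hn ▸ card_quotient_lt hN) (G ⧸ N) _ rfl (h.map (QuotientGroup.mk'_surjective N))
        (fun i => isSolvable_map _ _) (fun i => (hact i).map _ hp hq)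
        fun i j hij hi hj => hprimes i j hij ?_ ?_
      exacts [groupPrimes_subset_of_dvd (Subgroup.card_map_dvd _ _) hi,
        groupPrimes_subset_of_dvd (Subgroup.card_map_dvd _ _) hj]
    rcases subsingleton_or_nontrivial G with hG | hG
    · exact fun _ _ _ _ _ _ _ => Subsingleton.elim _ _
    obtain ⟨i, r, hr, x, hxi, hx, hx1⟩ := h.exists_mem_oPi hsol
    have : Fact r.Prime := ⟨hr⟩
    by_cases hrp : r = p
    · subst hrp
      have hR := h.iSup_inf_normal (oPi {r} G)
      have hRle : (⨆ i, oPi {r} G ⊓ H i) ≤ oPi {r} G := iSup_le fun i => inf_le_left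
      refine (quot _ hR ?_).of_quotient hp hq hpq fun x hx z hz _ =>
        h.commute_of_forall_factor hq (fun j x hxj hx z hz => ?_) hx hz
      · intro hbot
        have : x ∈ ⨆ i, oPi {r} G ⊓ H i := Subgroup.mem_iSup_of_mem i ⟨hx, hxi⟩
        rw [hbot] at this
        exact hx1 this
      · obtain ⟨k, hk⟩ := hx
        suffices (⨆ i, oPi {r} G ⊓ H i) ≤ Subgroup.centralizer {x} from
          (Subgroup.mem_centralizer_singleton_iff.1 (this hz)).symm
        refine iSup_le fun i y hy => Subgroup.mem_centralizer_singleton_iff.2 (Eq.symm ?_)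
        by_cases hij : i = j
        · subst hij
          exact (hact i).commute_of_mem inf_le_right ((isPGroup_oPi hp).to_le inf_le_left) hxj
            ⟨k, hk⟩ (fun u hu => ⟨(oPi_normal _ _).conj_mem u hu.1 x,
              (H i).mul_mem ((H i).mul_mem hxj hu.2) ((H i).inv_mem hxj)⟩) hy
        have one_of : ∀ {s m : ℕ}, s.Prime → ∀ {K : Subgroup G} {g : G}, g ∈ K → g ^ s ^ m = 1 →
            s ∉ groupPrimes K → g = 1 := by
          intro s m hs K g hg hgm hsK
          have hnd : ¬ s ∣ Nat.card K := fun hd => hsK ⟨hs, hd⟩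
          rw [← orderOf_eq_one_iff]
          refine Nat.eq_one_of_dvd_coprimes (Nat.Coprime.pow_left m
            ((Nat.Prime.coprime_iff_not_dvd hs).2 hnd)) (orderOf_dvd_of_pow_eq_one hgm) ?_
          rw [← Nat.card_zpowers]
          exact Subgroup.card_dvd_of_le (Subgroup.zpowers_le.2 hg)
        -- The arithmetic hypothesis is available only if `r` and `q` divide the respective orders;
        -- otherwise `y` or `x` is trivial.
        by_cases hri : r ∈ groupPrimes (H i)
        · by_cases hqj : q ∈ groupPrimes (H j)
          · exact commute_of_mutuallyPermutable hp hq hpq (isPGroup_oPi hp) (h.mutPerm i j hij)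
              (hact j) (hprimes i j hij hri hqj) hxj hk hy
          · rw [one_of hq hxj hk hqj, one_mul, mul_one]
        · obtain ⟨m, hm⟩ := (isPGroup_oPi hp).exists_pow_eq_one hy.1
          rw [one_of hp hy.2 hm hri, one_mul, mul_one]
    · refine (quot (oPi {r} G) inferInstance fun hbot => hx1 (by
        rwa [hbot, Subgroup.mem_bot] at hx)).of_quotient_of_coprime hp hq hpq fun hd => hrp ?_
      exact ((isPGroup_iff_groupPrimes hr).1 (isPGroup_oPi hr) ⟨hp, hd⟩).symm

end MutPermProduct

/-! ### Schmidt subgroups and trivial action -/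

section Schmidt

variable {G : Type*} [Group G] [Finite G] {p q : ℕ}

theorem isNilpotent_of_groupPrimes_subset (hp : p.Prime) (h : groupPrimes G ⊆ {p}) :
    Group.IsNilpotent G :=
  have : Fact p.Prime := ⟨hp⟩
  ((isPGroup_iff_groupPrimes hp).2 h).isNilpotent

theorem commute_of_isNilpotent [Group.IsNilpotent G] (hp : p.Prime) (hq : q.Prime) (hpq : p ≠ q)
    {x y : G} {k m : ℕ} (hx : x ^ p ^ k = 1) (hy : y ^ q ^ m = 1) : x * y = y * x := by
  have : Fact p.Prime := ⟨hp⟩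
  have : Fact q.Prime := ⟨hq⟩
  have hX : IsPGroup p (Subgroup.zpowers x) :=
    IsPGroup.of_card_dvd_pow (n := k) (by rw [Nat.card_zpowers]; exact orderOf_dvd_of_pow_eq_one hx)
  have hY : IsPGroup q (Subgroup.zpowers y) :=
    IsPGroup.of_card_dvd_pow (n := m) (by rw [Nat.card_zpowers]; exact orderOf_dvd_of_pow_eq_one hy)
  obtain ⟨P, hP⟩ := hX.exists_le_sylow
  obtain ⟨Q, hQ⟩ := hY.exists_le_sylow
  exact Subgroup.commute_of_normal_of_disjoint (P : Subgroup G) Q inferInstance inferInstance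
    (IsPGroup.disjoint_of_ne p q hpq _ _ P.2 Q.2) x y (hP (Subgroup.mem_zpowers x))
    (hQ (Subgroup.mem_zpowers y))

/-- A noncentral action of `x` on `P` makes `P⟨x⟩` non-nilpotent. A minimal non-nilpotent subgroup
`S` of it is a Schmidt group, and `P ⊓ S` is its normal Sylow `p`-subgroup. -/
theorem exists_isSchmidtPair (hp : p.Prime) (hq : q.Prime) (hpq : p ≠ q)
    (h : ¬ ActsTrivially p q G) : ∃ S : Subgroup G, IsSchmidtPair p q S := by
  have : Fact p.Prime := ⟨hp⟩
  unfold ActsTrivially at h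
  push Not at h
  obtain ⟨P, x, hP, ⟨k, hk⟩, hn, u, hu, hne⟩ := h
  have hxP : Subgroup.zpowers x ≤ Subgroup.normalizer (P : Set G) :=
    Subgroup.zpowers_le.2 (mem_normalizer_of_forall_conj_mem hn)
  have permutes_of : ∀ K : Subgroup G, K ≤ Subgroup.normalizer (P : Set G) → Permutes P K :=
    fun K hK => permutes_iff.2 fun g hg y hy => ⟨y, hy, y⁻¹ * g * y,
      (Subgroup.mem_normalizer_iff''.1 (hK hy) g).1 hg, by group⟩
  set K := P ⊔ Subgroup.zpowers x with hK
  have hKP : K ≤ Subgroup.normalizer (P : Set G) := sup_le Subgroup.le_normalizer hxP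
  have hxcard : Nat.card (Subgroup.zpowers x) ∣ q ^ k := by
    rw [Nat.card_zpowers]
    exact orderOf_dvd_of_pow_eq_one hk
  have hindex : ¬ p ∣ P.relIndex K := by
    rw [(permutes_of _ hxP).relIndex_sup]
    intro hd
    have := hp.dvd_of_dvd_pow (hd.trans ((Subgroup.relIndex_dvd_card _ _).trans hxcard))
    exact hpq ((Nat.prime_dvd_prime_iff_eq hp hq).1 this)
  have hKnil : ¬ Group.IsNilpotent K := by
    intro hnil
    obtain ⟨m, hm⟩ := hP.exists_pow_eq_one hu
    exact hne (congrArg Subtype.val (commute_of_isNilpotent (G := K) hq hp hpq.symm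
      (x := ⟨x, Subgroup.mem_sup_right (Subgroup.mem_zpowers x)⟩)
      (y := ⟨u, Subgroup.mem_sup_left hu⟩) (Subtype.ext hk) (Subtype.ext hm)))
  obtain ⟨S, hSK, hS⟩ := (Set.toFinite {S : Subgroup G | ¬ Group.IsNilpotent S}).exists_le_minimal
    hKnil
  have hprimes : groupPrimes S ⊆ {p, q} := by
    refine (groupPrimes_mono hSK).trans ((permutes_of _ hxP).groupPrimes_sup_subset.trans ?_)
    rintro r (hr | hr)
    · exact Or.inl ((isPGroup_iff_groupPrimes hp).1 hP hr)
    · exact Or.inr ((Nat.prime_dvd_prime_iff_eq hr.1 hq).1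
        (hr.1.dvd_of_dvd_pow (hr.2.trans hxcard)))
  refine ⟨S, ⟨hS.1, fun T hT => ?_⟩, hprimes.antisymm ?_, ?_⟩
  · by_contra hTn
    have hTS : T.map S.subtype ≤ S := by
      rintro _ ⟨t, -, rfl⟩
      exact t.2
    have := hS.2 (y := T.map S.subtype) (fun hnil => hTn ((Group.isNilpotent_congr
      (T.equivMapOfInjective S.subtype S.subtype_injective)).2 hnil)) hTS
    exact hT (eq_top_iff.2 fun s _ => by
      obtain ⟨t, ht, e⟩ := this s.2
      exact (Subtype.ext e : t = s) ▸ ht)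
  · have hsub : ∀ a b : ℕ, b.Prime → groupPrimes S ⊆ {a, b} → a ∈ groupPrimes S := by
      intro a b hb hab
      by_contra ha
      refine hS.1 (isNilpotent_of_groupPrimes_subset hb fun r hr => ?_)
      rcases hab hr with h | h
      · exact absurd (h ▸ hr) ha
      · exact h
    rintro r (rfl | rfl)
    · exact hsub r q hq hprimes
    · exact hsub r p hp (Set.pair_comm p r ▸ hprimes)
  · have hPS : IsPGroup p (P.subgroupOf S) := hP.comap_subtype
    have hPindex : ¬ p ∣ (P.subgroupOf S).index := by
      intro hd
      apply hindex
      have hle : P ⊔ S ≤ K := sup_le le_sup_left hSK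
      rw [← Subgroup.relIndex_mul_relIndex P (P ⊔ S) K le_sup_left hle,
        (permutes_of S (hSK.trans hKP)).relIndex_sup]
      exact Dvd.dvd.mul_right hd _
    refine ⟨hPS.toSylow hPindex, ⟨fun y hy s => ?_⟩⟩
    rw [IsPGroup.toSylow_coe] at hy ⊢
    exact (Subgroup.mem_normalizer_iff.1 (hKP (hSK s.2)) y).1 hy

/-- Otherwise the normal Sylow `p`-subgroup would commute with every Sylow `q`-subgroup, so the
normalizer of the latter would have index prime to both `p` and `q`; all Sylow subgroups would be
normal and `S` nilpotent. -/
theorem IsSchmidtPair.not_actsTrivially {S : Type*} [Group S] [Finite S]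
    (hS : IsSchmidtPair p q S) : p.Prime ∧ q.Prime ∧ p ≠ q ∧ ¬ ActsTrivially p q S := by
  obtain ⟨⟨hnil, -⟩, hprimes, P, hPn⟩ := hS
  have hpS : p ∈ groupPrimes S := by simp [hprimes]
  have hqS : q ∈ groupPrimes S := by simp [hprimes]
  have hp : p.Prime := hpS.1
  have hq : q.Prime := hqS.1
  have : Fact p.Prime := ⟨hp⟩
  refine ⟨hp, hq, ?_, fun hact => hnil ?_⟩
  · rintro rfl
    exact hnil (isNilpotent_of_groupPrimes_subset hp (by rw [hprimes]; simp))
  · refine ((Group.isNilpotent_of_finite_tfae (G := S)).out 0 3).2 fun r hr R => ?_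
    have hrp : r.Prime := hr.out
    have : Fact r.Prime := ⟨hrp⟩
    by_cases h1 : r ∈ groupPrimes S
    · by_cases h2 : r = p
      · subst h2
        obtain ⟨g, rfl⟩ := MulAction.exists_smul_eq S P R
        rwa [Sylow.smul_eq_of_normal]
      have h3 : r = q := by
        have : r ∈ ({p, q} : Set ℕ) := hprimes ▸ h1
        exact this.resolve_left h2
      subst h3
      rw [← Subgroup.normalizer_eq_top_iff, ← Subgroup.index_eq_one]
      have hPN : (P : Subgroup S) ≤ Subgroup.normalizer ((R : Subgroup S) : Set S) := by
        intro u hu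
        refine mem_normalizer_of_forall_conj_mem fun x hx => ?_
        have := hact P x P.2 (IsPGroup.exists_pow_eq_one R.2 hx)
          (fun v hv => hPn.conj_mem v hv x) u hu
        rwa [← this, mul_inv_cancel_right]
      by_contra hne
      obtain ⟨s, hs, hd⟩ := Nat.exists_prime_and_dvd hne
      have hsS : s ∈ groupPrimes S := ⟨hs, hd.trans (Subgroup.index_dvd_card _)⟩
      rw [hprimes] at hsS
      rcases hsS with rfl | hsr
      · exact P.not_dvd_index (hd.trans (Subgroup.index_dvd_of_le hPN))
      · obtain rfl : s = r := hsr
        exact R.not_dvd_index (hd.trans (Subgroup.index_dvd_of_le Subgroup.le_normalizer))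
    · have hbot : (R : Subgroup S) = ⊥ := by
        rw [← Subgroup.card_eq_one]
        exact (IsPGroup.card_eq_or_dvd R.2).resolve_right fun hd =>
          h1 ⟨hrp, hd.trans (Subgroup.card_subgroup_dvd_card _)⟩
      rw [hbot]
      infer_instance

end Schmidt

/-! ### The Hawkes graph of a soluble group and trivial action -/

section Hawkes

theorem eq_one_of_pow_eq_one_of_not_dvd {G : Type*} [Group G] {p : ℕ} (hp : p.Prime)
    (h : ¬ p ∣ Nat.card G) {x : G} {k : ℕ} (hx : x ^ p ^ k = 1) : x = 1 := by
  rw [← orderOf_eq_one_iff]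
  exact Nat.eq_one_of_dvd_coprimes (Nat.Coprime.pow_left k
    ((Nat.Prime.coprime_iff_not_dvd hp).2 h)) (orderOf_dvd_of_pow_eq_one hx) (orderOf_dvd_natCard x)

theorem dvd_card_of_not_actsTrivially {G : Type*} [Group G] {p q : ℕ} (hp : p.Prime) (h : ¬ ActsTrivially p q G) :
    p ∣ Nat.card G := by
  by_contra hd
  refine h fun P x hP _ _ u hu => ?_
  obtain ⟨n, hn⟩ := hP.exists_pow_eq_one hu
  rw [eq_one_of_pow_eq_one_of_not_dvd hp hd hn, mul_one, one_mul]

variable {G : Type*} [Group G] [Finite G] {p q : ℕ}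

theorem not_dvd_card_oPi (hp : p.Prime) :
    ¬ p ∣ Nat.card (oPi {r | r.Prime ∧ r ≠ p} G) :=
  fun hd => (groupPrimes_oPi {r | r.Prime ∧ r ≠ p} ⟨hp, hd⟩).2 rfl

instance oPrimeP_normal (p : ℕ) (G : Type*) [Group G] : (oPrimeP p G).Normal := by
  unfold oPrimeP
  infer_instance

/-- A `q`-element dies modulo `O_{p',p}(G)`, so its image modulo `O_{p'}(G)` is both a `p`- and a
`q`-element and `x ∈ O_{p'}(G)`. The commutator of `x` and `u` then lies in `P ⊓ O_{p'}(G) = 1`. -/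
theorem actsTrivially_of_not_dvd_card_quotient (hp : p.Prime) (hq : q.Prime) (hpq : p ≠ q)
    (h : ¬ q ∣ Nat.card (G ⧸ oPrimeP p G)) : ActsTrivially p q G := by
  rintro P x hP ⟨k, hk⟩ hn u hu
  let O := oPi {r | r.Prime ∧ r ≠ p} G
  have hx1 : x ∈ oPrimeP p G := (QuotientGroup.eq_one_iff x).1
    (eq_one_of_pow_eq_one_of_not_dvd hq h (k := k) (by rw [← QuotientGroup.mk_pow, hk]; rfl))
  have hx2 : (x : G ⧸ O) ∈ oPi {p} (G ⧸ O) := hx1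
  obtain ⟨m, hm⟩ := (isPGroup_oPi hp).exists_pow_eq_one hx2
  have hxO : x ∈ O := (QuotientGroup.eq_one_iff x).1 (eq_one_of_pow_eq_one_of_pow_eq_one hp hq hpq
    hm (m := k) (by rw [← QuotientGroup.mk_pow, hk]; rfl))
  have hzP : x * u * x⁻¹ * u⁻¹ ∈ P := P.mul_mem (hn u hu) (P.inv_mem hu)
  have hzO : x * u * x⁻¹ * u⁻¹ ∈ O := by
    have := O.mul_mem hxO ((oPi_normal _ G).conj_mem _ (O.inv_mem hxO) u)
    simpa [mul_assoc] using this
  obtain ⟨n, hn'⟩ := hP.exists_pow_eq_one hzP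
  have : x * u * x⁻¹ * u⁻¹ = 1 := congrArg Subtype.val (eq_one_of_pow_eq_one_of_not_dvd (G := O)
    (x := ⟨_, hzO⟩) hp (not_dvd_card_oPi hp) (Subtype.ext hn'))
  exact mul_inv_eq_iff_eq_mul.1 (mul_inv_eq_one.1 this)

/-- The Hall–Higman lemma for soluble groups. -/
theorem centralizer_oPi_le [Group.IsSolvable G] (hp : p.Prime)
    (hO : ∀ N : Subgroup G, N.Normal → ¬ p ∣ Nat.card N → N = ⊥) :
    Subgroup.centralizer (oPi {p} G : Set G) ≤ oPi {p} G := by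
  by_contra hC
  have : Fact p.Prime := ⟨hp⟩
  let C := Subgroup.centralizer (oPi {p} G : Set G)
  let Z := C ⊓ oPi {p} G
  let f := QuotientGroup.mk' Z
  have hfker : ∀ g, f g = 1 ↔ g ∈ Z := QuotientGroup.eq_one_iff
  have hCn : (C.map f).Normal :=
    Subgroup.Normal.map inferInstance f (QuotientGroup.mk'_surjective Z)
  have hne : C.map f ≠ ⊥ := fun hbot => hC fun c hc => by
    have : f c ∈ C.map f := ⟨c, hc, rfl⟩
    rw [hbot, Subgroup.mem_bot, hfker] at this
    exact this.2
  obtain ⟨r, hr, _, ⟨c, hc, rfl⟩, hcr, hc1⟩ := exists_mem_oPi_of_normal hne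
  have : Fact r.Prime := ⟨hr⟩
  let M := C ⊓ (oPi {r} (G ⧸ Z)).comap f
  have hcM : c ∈ M := ⟨hc, hcr⟩
  -- If `r = p`, then `M` is a normal `p`-subgroup and `c` falls into `Z`. If `r ≠ p`, then `M` is a
  -- central extension of an `r`-group, hence nilpotent; its Sylow `r`-subgroup is nontrivial and
  -- lies in a normal `p'`-subgroup of `G`, against `hO`.
  by_cases hrp : r = p
  · subst hrp
    have hker : IsPGroup r f.ker := by
      rw [QuotientGroup.ker_mk']
      exact (isPGroup_oPi hp).to_le inf_le_right
    have hM : IsPGroup r M :=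
      ((isPGroup_oPi hp).comap_of_ker_isPGroup f hker).to_le inf_le_right
    exact hc1 ((hfker c).2 ⟨hc, hM.le_oPi hp hcM⟩)
  · let φ : M →* oPi {r} (G ⧸ Z) := (f.comp M.subtype).codRestrict _ fun m => m.2.2
    have hnil : Group.IsNilpotent (oPi {r} (G ⧸ Z)) := (isPGroup_oPi hr).isNilpotent
    have hMnil : Group.IsNilpotent M := by
      refine Subgroup.isNilpotent_of_ker_le_center φ fun z hz => ?_
      have hzZ : (z : G) ∈ Z := (hfker z).1 (congrArg Subtype.val hz)
      exact Subgroup.mem_center_iff.2 fun m =>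
        Subtype.ext (Subgroup.mem_centralizer_iff.1 m.2.1 z hzZ.2).symm
    obtain ⟨R⟩ : Nonempty (Sylow r M) := inferInstance
    have hbot : coreIn r M = ⊥ := by
      refine hO _ ⟨fun y hy g => conj_mem_coreIn_of_normalized hr
        (fun m hm => (inferInstance : M.Normal).conj_mem m hm g) hy⟩ fun hd => hrp ?_
      exact ((isPGroup_iff_groupPrimes hr).1 (isPGroup_coreIn hr M) ⟨hp, hd⟩).symm
    have hdvd : r ∣ Nat.card M := by
      have h1 : r ∣ orderOf (f c) := by
        have := (isPGroup_oPi hr).dvd_orderOf (g := ⟨f c, hcr⟩) fun h => hc1 (congrArg Subtype.val h)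
        rwa [Subgroup.orderOf_mk] at this
      refine h1.trans ((orderOf_map_dvd f c).trans ?_)
      rw [← Nat.card_zpowers]
      exact Subgroup.card_dvd_of_le (Subgroup.zpowers_le.2 hcM)
    apply R.ne_bot_of_dvd_card hdvd
    rw [eq_bot_iff]
    intro y hy
    have hyR : (y : G) ∈ coreIn r M := ⟨y, IsPGroup.le_oPi hr R.2 hy, rfl⟩
    rw [hbot] at hyR
    exact Subtype.ext hyR

/-- Modulo `O_{p'}(G)` a `q`-element centralizes `O_p`, which contains its own centralizer by the
Hall–Higman lemma. The element is then also a `p`-element, hence trivial. -/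
theorem ActsTrivially.not_dvd_card_quotient [Group.IsSolvable G] (hp : p.Prime) (hq : q.Prime)
    (hpq : p ≠ q) (h : ActsTrivially p q G) : ¬ q ∣ Nat.card (G ⧸ oPrimeP p G) := by
  have : Fact q.Prime := ⟨hq⟩
  let O := oPi {r | r.Prime ∧ r ≠ p} G
  have hact : ActsTrivially p q (G ⧸ O) := h.of_surjective (QuotientGroup.mk'_surjective O) hp hq
  have hO : ∀ N : Subgroup (G ⧸ O), N.Normal → ¬ p ∣ Nat.card N → N = ⊥ := by
    intro N hN hpN
    have : Fact p.Prime := ⟨hp⟩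
    let f := QuotientGroup.mk' O
    have hcomap : ¬ p ∣ Nat.card (N.comap f) := by
      intro hd
      obtain ⟨y, hy⟩ := exists_prime_orderOf_dvd_card' p hd
      have hyp : (y : G) ^ p ^ 1 = 1 := by
        rw [pow_one]
        exact orderOf_dvd_iff_pow_eq_one.1 (by rw [Subgroup.orderOf_coe, hy])
      have hyN : (⟨f y, y.2⟩ : N) = 1 := eq_one_of_pow_eq_one_of_not_dvd hp hpN (k := 1)
        (Subtype.ext (by
          change f y ^ p ^ 1 = 1
          rw [← map_pow, hyp, map_one]))
      have hyO : (y : G) ∈ O := (QuotientGroup.eq_one_iff _).1 (congrArg Subtype.val hyN)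
      have hy1 : (⟨y, hyO⟩ : O) = 1 := eq_one_of_pow_eq_one_of_not_dvd hp (not_dvd_card_oPi hp)
        (Subtype.ext hyp)
      have hy1' : y = 1 := Subtype.ext (congrArg (fun z : O => (z : G)) hy1)
      rw [hy1', orderOf_one] at hy
      exact hp.one_lt.ne hy
    have hle : N.comap f ≤ O := le_oPi fun r hr => ⟨hr.1, fun h => hcomap (h ▸ hr.2)⟩
    rw [← Subgroup.map_comap_eq_self_of_surjective (QuotientGroup.mk'_surjective O) N, eq_bot_iff]
    rintro _ ⟨y, hy, rfl⟩
    exact (QuotientGroup.eq_one_iff y).2 (hle hy)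
  have hle := centralizer_oPi_le hp hO
  intro hd
  have hd' : q ∣ Nat.card (G ⧸ O) := by
    rw [← Subgroup.index_eq_card, oPrimeP,
      Subgroup.index_comap_of_surjective _ (QuotientGroup.mk'_surjective _)] at hd
    exact hd.trans (Subgroup.index_dvd_card _)
  obtain ⟨x, hx⟩ := exists_prime_orderOf_dvd_card' q hd'
  have hxq : x ^ q ^ 1 = 1 := by rw [pow_one, ← hx, pow_orderOf_eq_one]
  have hxP : x ∈ oPi {p} (G ⧸ O) := hle (Subgroup.mem_centralizer_iff.2 fun u hu =>
    (hact _ x (isPGroup_oPi hp) ⟨1, hxq⟩ (fun v hv => (oPi_normal _ _).conj_mem v hv x) u hu).symm)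
  obtain ⟨m, hm⟩ := (isPGroup_oPi hp).exists_pow_eq_one hxP
  rw [eq_one_of_pow_eq_one_of_pow_eq_one hp hq hpq hm hxq, orderOf_one] at hx
  exact hq.one_lt.ne hx

end Hawkes

/-! ### Translation into graphs -/

section Graphs

theorem list_prod_subset {G : Type*} [Group G] (K : Subgroup G) :
    ∀ l : List (Set G), (∀ s ∈ l, s ⊆ K) → l.prod ⊆ K
  | [], _ => by simp [K.one_mem]
  | s :: l, h => by
    rw [List.prod_cons]
    rintro _ ⟨a, ha, b, hb, rfl⟩
    exact K.mul_mem (h s (by simp) ha) (list_prod_subset K l (fun t ht => h t (by simp [ht])) hb)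

theorem IsProductOf.sup_eq_top {G : Type*} [Group G] {n : ℕ} {H : Fin n → Subgroup G}
    (h : IsProductOf H) : Finset.univ.sup H = ⊤ := by
  refine eq_top_iff.2 fun x _ => ?_
  have hx : x ∈ (List.ofFn fun i => (H i : Set G)).prod := by
    rw [show (List.ofFn fun i => (H i : Set G)).prod = Set.univ from h]
    trivial
  refine list_prod_subset _ _ (fun s hs => ?_) hx
  obtain ⟨i, rfl⟩ := List.mem_ofFn.1 hs
  exact SetLike.coe_subset_coe.2 (Finset.le_sup (Finset.mem_univ i))

theorem mem_nCriticalGraph_edges {G : Type*} [Group G] [Finite G] {p q : ℕ} :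
    (p, q) ∈ (nCriticalGraph G).edges ↔
      p.Prime ∧ q.Prime ∧ p ≠ q ∧ ¬ ActsTrivially p q G := by
  constructor
  · rintro ⟨S, hS⟩
    obtain ⟨hp, hq, hpq, h⟩ := hS.not_actsTrivially
    exact ⟨hp, hq, hpq, fun hG => h (hG.subgroup S)⟩
  · rintro ⟨hp, hq, hpq, h⟩
    exact exists_isSchmidtPair hp hq hpq h

theorem mem_hawkesGraph_edges {G : Type*} [Group G] [Finite G] [Group.IsSolvable G] {p q : ℕ}
    (hpq : p ≠ q) : (p, q) ∈ (hawkesGraph G).edges ↔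
      p.Prime ∧ q.Prime ∧ ¬ ActsTrivially p q G := by
  constructor
  · rintro ⟨hp, hq⟩
    exact ⟨hp.1, hq.1, fun h => h.not_dvd_card_quotient hp.1 hq.1 hpq hq.2⟩
  · rintro ⟨hp, hq, h⟩
    refine ⟨⟨hp, dvd_card_of_not_actsTrivially hp h⟩, hq, ?_⟩
    by_contra hd
    exact h (actsTrivially_of_not_dvd_card_quotient hp hq hpq hd)

theorem MutPermProduct.exists_not_actsTrivially {G ι : Type*} [Group G] [Finite G] [Fintype ι]
    {H : ι → Subgroup G} (h : MutPermProduct H) (hsol : ∀ i, Group.IsSolvable (H i)) {p q : ℕ}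
    (hp : p.Prime) (hq : q.Prime) (hpq : p ≠ q) (hG : ¬ ActsTrivially p q G) :
    (∃ i, ¬ ActsTrivially p q (H i)) ∨
      ∃ x : {x : ι × ι // x.1 ≠ x.2}, (p, q) ∈ (pairGraph (H x.1.1) (H x.1.2)).edges := by
  by_contra! hcon
  refine hG (h.actsTrivially hp hq hpq hsol hcon.1 fun i j hij hi hj hd => ?_)
  exact hcon.2 ⟨(i, j), hij⟩ (Or.inl ⟨hi, hj, hq, hd⟩)

end Graphs

theorem theorem4 {G : Type*} [Group G] [Finite G] {n : ℕ} (H : Fin n → Subgroup G)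
    (hprod : IsProductOf H)
    (hperm : ∀ i j : Fin n, i ≠ j → MutuallyPermutable (H i) (H j))
    (hsol : ∀ i : Fin n, Group.IsSolvable (H i)) :
    hawkesGraph G ⊆
        ArithGraph.iUnion (fun i : Fin n => hawkesGraph (H i)) ∪
          ArithGraph.iUnion (fun x : {x : Fin n × Fin n // x.1 ≠ x.2} =>
            pairGraph (H x.1.1) (H x.1.2)) ∪
          loopGraph G ∧
      nCriticalGraph G ⊆
        ArithGraph.iUnion (fun i : Fin n => nCriticalGraph (H i)) ∪
          ArithGraph.iUnion (fun x : {x : Fin n × Fin n // x.1 ≠ x.2} =>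
            pairGraph (H x.1.1) (H x.1.2)) := by
  have hH : MutPermProduct H := ⟨hperm, hprod.sup_eq_top⟩
  have hG : Group.IsSolvable G := hH.isSolvable hsol
  refine ⟨⟨fun p hp => ?_, ?_⟩, fun p hp => ?_, ?_⟩
  · obtain ⟨i, hi⟩ := Set.mem_iUnion.1 (hH.groupPrimes_subset hp)
    exact Or.inl (Or.inl (Set.mem_iUnion.2 ⟨i, hi⟩))
  · rintro ⟨p, q⟩ he
    by_cases hpq : p = q
    · subst hpq
      exact Or.inr ⟨he.1, rfl⟩
    · obtain ⟨hp, hq, hact⟩ := (mem_hawkesGraph_edges hpq).1 he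
      rcases hH.exists_not_actsTrivially hsol hp hq hpq hact with ⟨i, hi⟩ | ⟨x, hx⟩
      · have := hsol i
        exact Or.inl (Or.inl (Set.mem_iUnion.2 ⟨i, (mem_hawkesGraph_edges hpq).2 ⟨hp, hq, hi⟩⟩))
      · exact Or.inl (Or.inr (Set.mem_iUnion.2 ⟨x, hx⟩))
  · obtain ⟨i, hi⟩ := Set.mem_iUnion.1 (hH.groupPrimes_subset hp)
    exact Or.inl (Set.mem_iUnion.2 ⟨i, hi⟩)
  · rintro ⟨p, q⟩ he
    obtain ⟨hp, hq, hpq, hact⟩ := mem_nCriticalGraph_edges.1 he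
    rcases hH.exists_not_actsTrivially hsol hp hq hpq hact with ⟨i, hi⟩ | ⟨x, hx⟩
    · exact Or.inl (Set.mem_iUnion.2 ⟨i, mem_nCriticalGraph_edges.2 ⟨hp, hq, hpq, hi⟩⟩)
    · exact Or.inr (Set.mem_iUnion.2 ⟨x, hx⟩)
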